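/- A dg-category is a category enriched in chain complexes of abelian groups (differentials of degree $-1$, Koszul signs). Let $\mathcal S$ be the dg-category with objects $s,t$ generated by $f\colon s\to t$, $g\colon t\to s$ of degree $0$ and $h\colon s\to s$ of degree $1$, subject to $$Df=0,\quad Dg=0,\quad Dh=1-gf,\quad fg=1,\quad fh=0,\quad hg=0,\quad hh=0,$$ and let $\mathcal S_{\mathrm{ps,loc}}$ be the dg-category generated by $f,g,h$ with the same relations, together with $\delta\colon s\to s$ of degree $-1$ subject to $D\delta=-\delta^2$, and a two-sided inverse $(1+\delta h)^{-1}$ of $1+\delta h$. For a dg-category $\mathcal C$, $[\mathcal S,\mathcal C]$ and $[\mathcal S_{\mathrm{ps,loc}},\mathcal C]$ denote the dg-categories of dg-functors and dg-natural transformations (of all degrees). For $\delta\in\mathcal C(A,A)_{-1}$, a $\delta$-perturbation of $A$ is an object $A_\delta$ with a degree $0$ element $\varphi\in\mathcal C(A_\delta,A)_0$ such that composition with $\varphi$ is, for every object $B$, an isomorphism of complexes from $\mathcal C(B,A_\delta)$ onto $\mathcal C(B,A)$ with the differential $x\mapsto Dx+\delta x$. Then $\varphi$ has an inverse $\psi$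 in degree $0$. Let $\mathcal C$ be a dg-category closed under perturbations, i.e. such that a $\delta$-perturbation exists for every object $A$ and every $\delta\in\mathcal C(A,A)_{-1}$ with $D\delta=-\delta^2$; fix any choice of these perturbations. The perturbation lemma sends a diagram $X\in[\mathcal S_{\mathrm{ps,loc}},\mathcal C]$, i.e. a strong deformation retraction $(f,g,h)\colon A\to B$ with a perturbation $\delta$ of $A$ for which $1+\delta h$ is invertible, to the strong deformation retraction $\Phi X\in[\mathcal S,\mathcal C]$ from $A_\delta$ to $B_{\delta'}$, $\delta'=f(1+\delta h)^{-1}\delta g$, whose maps are $$\hat f=f(1+\delta h)^{-1},\quad \hat g=(1+h\delta)^{-1}g,\quad \hat h=h(1+\delta h)^{-1},$$ transferred to $A_\delta$ and $B_{\delta'}$ along the isomorphisms $\psi,\varphi$. **Theorem.** Let $\Phi$ send a dg-natural transformation (of any degree) $X\to Y$ to the family of its components, transferred along $\psi$ and $\varphi$ to the perturbed objects. This is well defined and makes $\Phi$ a dg-functor $[\mathcal S_{\mathrm{ps,loc}},\mathcal C]\to[\mathcal S,\mathcal C]$. Moreover $\Phi$ preserves all weighted limits and colimits, where (co)limits in dg-functor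 categories are understood to be computed pointwise, in the following sense: for every dg-category $\mathcal J$, every weight $W\colon\mathcal J\to\mathrm{Ch}$ and every dg-functor $F\colon\mathcal J\to[\mathcal S_{\mathrm{ps,loc}},\mathcal C]$ for which the $W$-weighted limits of $F(-)(s)$ and of $F(-)(t)$ exist in $\mathcal C$ (for instance, if $\mathcal C$ has all $W$-weighted limits), $\Phi$ sends every $W$-weighted limit cone over $F$ to a $W$-weighted limit cone over $\Phi F$; and dually for $W$-weighted colimits with $W\colon\mathcal J^{\mathrm{op}}\to\mathrm{Ch}$. -/

import Mathlib

universe v u v₁ u₁ v₂ u₂ v₃ u₃ w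

/-! # dg-categories

Complexes are `ℤ`-graded, with differentials of degree `-1`; all signs are Koszul signs. -/

/-- A dg-category: a category enriched in chain complexes of abelian groups.
`Hom X Y n` is the group of morphisms ("non-dg-maps") of degree `n`. Composition is written in the
order of functions: `comp g f h` is `g ∘ f`. So that degrees never have to be rewritten, `comp`
takes a proof that the degrees add up, and `D` a proof that the degree drops by one. -/
class DGCategory (C : Type u) where
  Hom : C → C → ℤ → Type v
  addCommGroupHom : ∀ X Y n, AddCommGroup (Hom X Y n)
  id : ∀ X, Hom X X 0
  comp : ∀ {X Y Z : C} {n m p : ℤ}, Hom Y Z n → Hom X Y m → n + m = p → Hom X Z p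
  D : ∀ {X Y : C} {n m : ℤ}, m + 1 = n → Hom X Y n → Hom X Y m
  add_comp : ∀ {X Y Z : C} {n m p : ℤ} (g g' : Hom Y Z n) (f : Hom X Y m) (h : n + m = p),
    comp (g + g') f h = comp g f h + comp g' f h
  comp_add : ∀ {X Y Z : C} {n m p : ℤ} (g : Hom Y Z n) (f f' : Hom X Y m) (h : n + m = p),
    comp g (f + f') h = comp g f h + comp g f' h
  id_comp : ∀ {X Y : C} {n : ℤ} (f : Hom X Y n) (h : 0 + n = n), comp (id Y) f h = f
  comp_id : ∀ {X Y : C} {n : ℤ} (f : Hom X Y n) (h : n + 0 = n), comp f (id X) h = f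
  assoc : ∀ {X Y Z T : C} {k n m p q r : ℤ} (a : Hom Z T k) (b : Hom Y Z n) (c : Hom X Y m)
    (hp : k + n = p) (hq : n + m = q) (hr : p + m = r) (hr' : k + q = r),
    comp (comp a b hp) c hr = comp a (comp b c hq) hr'
  D_add : ∀ {X Y : C} {n m : ℤ} (h : m + 1 = n) (f f' : Hom X Y n),
    D h (f + f') = D h f + D h f'
  D_D : ∀ {X Y : C} {n m k : ℤ} (h : m + 1 = n) (h' : k + 1 = m) (f : Hom X Y n),
    D h' (D h f) = 0
  D_id : ∀ (X : C) {m : ℤ} (h : m + 1 = 0), D h (id X) = 0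
  /-- The Leibniz rule `D (g f) = D g · f + (-1)^|g| g · D f`. -/
  D_comp : ∀ {X Y Z : C} {n m p n' m' p' : ℤ} (g : Hom Y Z n) (f : Hom X Y m) (h : n + m = p)
    (hn : n' + 1 = n) (hm : m' + 1 = m) (hp : p' + 1 = p) (h₁ : n' + m = p') (h₂ : n + m' = p'),
    D hp (comp g f h) = comp (D hn g) f h₁ + n.negOnePow • comp g (D hm f) h₂

namespace DGCategory

attribute [reducible, instance] DGCategory.addCommGroupHom

section Basic

variable {C : Type u} [DGCategory.{v} C] {X Y Z : C} {n m p k : ℤ}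

lemma zero_comp (f : Hom X Y m) (h : n + m = p) : comp (0 : Hom Y Z n) f h = 0 := by
  have := add_comp (0 : Hom Y Z n) 0 f h
  simpa using this

lemma comp_zero (g : Hom Y Z n) (h : n + m = p) : comp g (0 : Hom X Y m) h = 0 := by
  have := comp_add g (0 : Hom X Y m) 0 h
  simpa using this

lemma neg_comp (g : Hom Y Z n) (f : Hom X Y m) (h : n + m = p) :
    comp (-g) f h = - comp g f h := by
  rw [eq_neg_iff_add_eq_zero, ← add_comp, neg_add_cancel, zero_comp]

lemma comp_neg (g : Hom Y Z n) (f : Hom X Y m) (h : n + m = p) :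
    comp g (-f) h = - comp g f h := by
  rw [eq_neg_iff_add_eq_zero, ← comp_add, neg_add_cancel, comp_zero]

lemma sub_comp (g g' : Hom Y Z n) (f : Hom X Y m) (h : n + m = p) :
    comp (g - g') f h = comp g f h - comp g' f h := by
  rw [sub_eq_add_neg, add_comp, neg_comp, ← sub_eq_add_neg]

lemma comp_sub (g : Hom Y Z n) (f f' : Hom X Y m) (h : n + m = p) :
    comp g (f - f') h = comp g f h - comp g f' h := by
  rw [sub_eq_add_neg, comp_add, comp_neg, ← sub_eq_add_neg]

lemma D_zero (h : m + 1 = n) : D h (0 : Hom X Y n) = 0 := by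
  have := D_add h (0 : Hom X Y n) 0
  simpa using this

lemma D_neg (h : m + 1 = n) (f : Hom X Y n) : D h (-f) = - D h f := by
  rw [eq_neg_iff_add_eq_zero, ← D_add, neg_add_cancel, D_zero]

lemma D_sub (h : m + 1 = n) (f f' : Hom X Y n) : D h (f - f') = D h f - D h f' := by
  rw [sub_eq_add_neg, D_add, D_neg, ← sub_eq_add_neg]

lemma sign_cases {M : Type*} [AddCommGroup M] (k : ℤ) :
    (∀ x : M, k.negOnePow • x = x) ∨ (∀ x : M, k.negOnePow • x = -x) := by
  rcases Int.even_or_odd k with hk | hk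
  · left; intro x; rw [Int.negOnePow_even k hk, one_smul]
  · right; intro x; rw [Int.negOnePow_odd k hk, Units.neg_smul, one_smul]

lemma sign_comp (g : Hom Y Z n) (f : Hom X Y m) (h : n + m = p) :
    comp (k.negOnePow • g) f h = k.negOnePow • comp g f h := by
  rcases Int.even_or_odd k with hk | hk
  · simp [Int.negOnePow_even k hk]
  · simp [Int.negOnePow_odd k hk, neg_comp]

lemma comp_sign (g : Hom Y Z n) (f : Hom X Y m) (h : n + m = p) :
    comp g (k.negOnePow • f) h = k.negOnePow • comp g f h := by
  rcases Int.even_or_odd k with hk | hk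
  · simp [Int.negOnePow_even k hk]
  · simp [Int.negOnePow_odd k hk, comp_neg]

lemma D_sign (h : m + 1 = n) (f : Hom X Y n) :
    D h (k.negOnePow • f) = k.negOnePow • D h f := by
  rcases Int.even_or_odd k with hk | hk
  · simp [Int.negOnePow_even k hk]
  · simp [Int.negOnePow_odd k hk, D_neg]

end Basic

end DGCategory

open DGCategory

/-! ## dg-functors and the dg-category of dg-functors -/

/-- The laws of a dg-functor: compatibility with sums, identities, compositions, differentials. -/
structure IsDGFunctor {A : Type u₁} [DGCategory.{v₁} A] {B : Type u₂} [DGCategory.{v₂} B]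
    (obj : A → B) (map : ∀ {X Y : A} {n : ℤ}, Hom X Y n → Hom (obj X) (obj Y) n) : Prop where
  map_add : ∀ {X Y : A} {n : ℤ} (x y : Hom X Y n), map (x + y) = map x + map y
  map_id : ∀ X : A, map (DGCategory.id X) = DGCategory.id (obj X)
  map_comp : ∀ {X Y Z : A} {n m p : ℤ} (y : Hom Y Z n) (x : Hom X Y m) (h : n + m = p),
    map (comp y x h) = comp (map y) (map x) h
  map_D : ∀ {X Y : A} {n m : ℤ} (h : m + 1 = n) (x : Hom X Y n), map (D h x) = D h (map x)

/-- dg-functors. -/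
structure DGFunctor (A : Type u₁) [DGCategory.{v₁} A] (B : Type u₂) [DGCategory.{v₂} B] where
  obj : A → B
  map : ∀ {X Y : A} {n : ℤ}, Hom X Y n → Hom (obj X) (obj Y) n
  isDGFunctor : IsDGFunctor obj map

namespace DGFunctor

variable {A : Type u₁} [DGCategory.{v₁} A] {B : Type u₂} [DGCategory.{v₂} B]
  {C : Type u₃} [DGCategory.{v₃} C]

/-- The composite `G ∘ F`. -/
def comp (G : DGFunctor B C) (F : DGFunctor A B) : DGFunctor A C where
  obj a := G.obj (F.obj a)
  map x := G.map (F.map x)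
  isDGFunctor :=
    { map_add := fun x y => by rw [F.isDGFunctor.map_add, G.isDGFunctor.map_add]
      map_id := fun X => by rw [F.isDGFunctor.map_id, G.isDGFunctor.map_id]
      map_comp := fun y x h => by rw [F.isDGFunctor.map_comp, G.isDGFunctor.map_comp]
      map_D := fun h x => by rw [F.isDGFunctor.map_D, G.isDGFunctor.map_D] }

lemma map_zero (F : DGFunctor A B) {X Y : A} {n : ℤ} : F.map (0 : Hom X Y n) = 0 := by
  have := F.isDGFunctor.map_add (0 : Hom X Y n) 0
  simpa using this

lemma map_neg (F : DGFunctor A B) {X Y : A} {n : ℤ} (x : Hom X Y n) : F.map (-x) = -F.map x := by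
  rw [eq_neg_iff_add_eq_zero, ← F.isDGFunctor.map_add, neg_add_cancel, map_zero]

/-- dg-natural transformations `F → G` of degree `n`: families `φ a : F a → G a` of degree `n` such
that `φ b ∘ F x = (-1)^(n |x|) G x ∘ φ a` for all `x : a → b`. -/
def natTrans (F G : DGFunctor A B) (n : ℤ) :
    AddSubgroup (∀ a, Hom (F.obj a) (G.obj a) n) where
  carrier := {φ | ∀ {a b : A} {m p : ℤ} (x : Hom a b m) (h : n + m = p) (h' : m + n = p),
    DGCategory.comp (φ b) (F.map x) h = (n * m).negOnePow • DGCategory.comp (G.map x) (φ a) h'}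
  add_mem' := by
    intro φ χ hφ hχ a b m p x h h'
    simp only [Pi.add_apply, add_comp, comp_add, hφ x h h', hχ x h h', smul_add]
  zero_mem' := by
    intro a b m p x h h'
    simp only [Pi.zero_apply, zero_comp, comp_zero, smul_zero]
  neg_mem' := by
    intro φ hφ a b m p x h h'
    simp only [Pi.neg_apply, neg_comp, comp_neg, hφ x h h', smul_neg]

lemma natTrans_naturality {F G : DGFunctor A B} {n : ℤ} (φ : natTrans F G n) {a b : A} {m p : ℤ}
    (x : Hom a b m) (h : n + m = p) (h' : m + n = p) :
    DGCategory.comp (φ.1 b) (F.map x) h =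
      (n * m).negOnePow • DGCategory.comp (G.map x) (φ.1 a) h' :=
  φ.2 x h h'

lemma natTrans_sign {F G : DGFunctor A B} {n : ℤ} (k : ℤ) (φ : natTrans F G n) (a : A) :
    (k.negOnePow • φ).1 a = k.negOnePow • φ.1 a := by
  rcases Int.even_or_odd k with hk | hk
  · rw [Int.negOnePow_even _ hk, one_smul, one_smul]
  · rw [Int.negOnePow_odd _ hk, Units.neg_smul, Units.neg_smul, one_smul, one_smul]; rfl

/-- The identity transformation. -/
def natTransId (F : DGFunctor A B) : natTrans F F 0 :=
  ⟨fun a => DGCategory.id (F.obj a), by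
    intro a b m p x h h'
    obtain rfl : m = p := by lia
    rw [DGCategory.id_comp, DGCategory.comp_id]
    simp⟩

/-- The pointwise composite of transformations. -/
def natTransComp {F G H : DGFunctor A B} {n m p : ℤ} (φ : natTrans G H n) (χ : natTrans F G m)
    (hp : n + m = p) : natTrans F H p :=
  ⟨fun a => DGCategory.comp (φ.1 a) (χ.1 a) hp, by
    intro a b k q x h h'
    have e₁ := natTrans_naturality χ x (p := m + k) rfl (by lia)
    have e₂ := natTrans_naturality φ x (p := n + k) rfl (by lia)
    rw [assoc _ _ _ hp rfl h (by lia), e₁, comp_sign,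
      ← assoc (φ.1 b) (G.map x) (χ.1 a) rfl (by lia) (by lia) (by lia), e₂, sign_comp,
      assoc (H.map x) (φ.1 a) (χ.1 a) (by lia) hp (by lia) h', smul_smul,
      ← Int.negOnePow_add]
    congr 2
    rw [← hp]; ring⟩

/-- The pointwise differential of a transformation. -/
def natTransD {F G : DGFunctor A B} {n m : ℤ} (hm : m + 1 = n) (φ : natTrans F G n) :
    natTrans F G m :=
  ⟨fun a => D hm (φ.1 a), by
    intro a b k q x h h'
    have e := congrArg (D (m := q) (n := q + 1) rfl)
      (natTrans_naturality φ x (p := q + 1) (by lia) (by lia))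
    rw [D_sign, D_comp _ _ _ hm (m' := k - 1) (by lia) _ h (by lia),
      D_comp _ _ _ (n' := k - 1) (by lia) hm _ (by lia) h',
      ← F.isDGFunctor.map_D, ← G.isDGFunctor.map_D,
      natTrans_naturality φ (D (m := k - 1) (by lia) x) (p := q) (by lia) (by lia),
      smul_add, smul_smul, smul_smul,
      ← Int.negOnePow_add, ← Int.negOnePow_add,
      show n + n * (k - 1) = n * k by ring, add_comm, add_left_cancel_iff] at e
    rw [e]
    congr 1
    rw [show n * k + k = m * k + (k + k) by rw [← hm]; ring, Int.negOnePow_add,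
      Int.negOnePow_even (k + k) ⟨k, rfl⟩, mul_one]⟩

/-- The dg-category `[A, B]` of dg-functors, with pointwise operations on transformations. -/
instance instDGCategory : DGCategory.{max u₁ v₂} (DGFunctor A B) where
  Hom F G n := natTrans F G n
  addCommGroupHom _ _ _ := inferInstance
  id F := natTransId F
  comp φ χ h := natTransComp φ χ h
  D h φ := natTransD h φ
  add_comp _ _ _ _ := Subtype.ext (funext fun _ => DGCategory.add_comp _ _ _ _)
  comp_add _ _ _ _ := Subtype.ext (funext fun _ => DGCategory.comp_add _ _ _ _)
  id_comp _ _ := Subtype.ext (funext fun _ => DGCategory.id_comp _ _)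
  comp_id _ _ := Subtype.ext (funext fun _ => DGCategory.comp_id _ _)
  assoc _ _ _ _ _ _ _ := Subtype.ext (funext fun _ => DGCategory.assoc _ _ _ _ _ _ _)
  D_add _ _ _ := Subtype.ext (funext fun _ => DGCategory.D_add _ _ _)
  D_D _ _ _ := Subtype.ext (funext fun _ => DGCategory.D_D _ _ _)
  D_id _ _ _ := Subtype.ext (funext fun _ => DGCategory.D_id _ _)
  D_comp φ χ h hn hm hp h₁ h₂ := Subtype.ext (funext fun a =>
    (DGCategory.D_comp (φ.1 a) (χ.1 a) h hn hm hp h₁ h₂).trans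
      (congrArg _ (natTrans_sign _ (natTransComp φ (natTransD hm χ) h₂) a).symm))

/-- The component at `a` of a transformation. -/
def app {F G : DGFunctor A B} {n : ℤ} (φ : Hom F G n) (a : A) : Hom (F.obj a) (G.obj a) n :=
  (show natTrans F G n from φ).1 a

/-- Evaluation at `a`, a dg-functor `[A, B] → B`. -/
def eval (a : A) : DGFunctor (DGFunctor A B) B where
  obj F := F.obj a
  map φ := app φ a
  isDGFunctor :=
    { map_add := fun _ _ => rfl
      map_id := fun _ => rfl
      map_comp := fun _ _ _ => rfl
      map_D := fun _ _ => rfl }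

end DGFunctor

/-! ## Weighted limits and colimits -/

/-- A weight for limits of shape `J`, that is a dg-functor from `J` to chain complexes, given as a
left dg-module over `J`: complexes `W j` with an action `x • w ∈ W j` of `x : i → j` on `w ∈ W i`
that is a chain map `Hom i j ⊗ W i → W j`. -/
structure LimitWeight (J : Type u₁) [DGCategory.{v₁} J] where
  obj : J → ℤ → Type w
  [addCommGroup : ∀ j n, AddCommGroup (obj j n)]
  d : ∀ {j : J} {n m : ℤ}, m + 1 = n → obj j n → obj j m
  act : ∀ {i j : J} {n m p : ℤ}, Hom i j n → obj i m → n + m = p → obj j p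
  d_add : ∀ {j : J} {n m : ℤ} (h : m + 1 = n) (w w' : obj j n), d h (w + w') = d h w + d h w'
  d_d : ∀ {j : J} {n m k : ℤ} (h : m + 1 = n) (h' : k + 1 = m) (w : obj j n), d h' (d h w) = 0
  add_act : ∀ {i j : J} {n m p : ℤ} (x x' : Hom i j n) (w : obj i m) (h : n + m = p),
    act (x + x') w h = act x w h + act x' w h
  act_add : ∀ {i j : J} {n m p : ℤ} (x : Hom i j n) (w w' : obj i m) (h : n + m = p),
    act x (w + w') h = act x w h + act x w' h
  id_act : ∀ {j : J} {m : ℤ} (w : obj j m) (h : 0 + m = m), act (DGCategory.id j) w h = w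
  comp_act : ∀ {i j l : J} {k n m p q r : ℤ} (y : Hom j l k) (x : Hom i j n) (w : obj i m)
    (hp : k + n = p) (hq : n + m = q) (hr : p + m = r) (hr' : k + q = r),
    act (DGCategory.comp y x hp) w hr = act y (act x w hq) hr'
  d_act : ∀ {i j : J} {n m p n' m' p' : ℤ} (x : Hom i j n) (w : obj i m) (h : n + m = p)
    (hn : n' + 1 = n) (hm : m' + 1 = m) (hp : p' + 1 = p) (h₁ : n' + m = p') (h₂ : n + m' = p'),
    d hp (act x w h) = act (D hn x) w h₁ + n.negOnePow • act x (d hm w) h₂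

attribute [instance] LimitWeight.addCommGroup

/-- A weight for colimits of shape `J`, that is a dg-functor from `Jᵒᵖ` to chain complexes, given
as a right dg-module over `J`. -/
structure ColimitWeight (J : Type u₁) [DGCategory.{v₁} J] where
  obj : J → ℤ → Type w
  [addCommGroup : ∀ j n, AddCommGroup (obj j n)]
  d : ∀ {j : J} {n m : ℤ}, m + 1 = n → obj j n → obj j m
  act : ∀ {i j : J} {n m p : ℤ}, obj j n → Hom i j m → n + m = p → obj i p
  d_add : ∀ {j : J} {n m : ℤ} (h : m + 1 = n) (w w' : obj j n), d h (w + w') = d h w + d h w'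
  d_d : ∀ {j : J} {n m k : ℤ} (h : m + 1 = n) (h' : k + 1 = m) (w : obj j n), d h' (d h w) = 0
  add_act : ∀ {i j : J} {n m p : ℤ} (w w' : obj j n) (x : Hom i j m) (h : n + m = p),
    act (w + w') x h = act w x h + act w' x h
  act_add : ∀ {i j : J} {n m p : ℤ} (w : obj j n) (x x' : Hom i j m) (h : n + m = p),
    act w (x + x') h = act w x h + act w x' h
  act_id : ∀ {j : J} {n : ℤ} (w : obj j n) (h : n + 0 = n), act w (DGCategory.id j) h = w
  act_comp : ∀ {i j l : J} {k n m p q r : ℤ} (w : obj l k) (y : Hom j l n) (x : Hom i j m)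
    (hp : k + n = p) (hq : n + m = q) (hr : k + q = r) (hr' : p + m = r),
    act w (DGCategory.comp y x hq) hr = act (act w y hp) x hr'
  d_act : ∀ {i j : J} {n m p n' m' p' : ℤ} (w : obj j n) (x : Hom i j m) (h : n + m = p)
    (hn : n' + 1 = n) (hm : m' + 1 = m) (hp : p' + 1 = p) (h₁ : n' + m = p') (h₂ : n + m' = p'),
    d hp (act w x h) = act (d hn w) x h₁ + n.negOnePow • act w (D hm x) h₂

attribute [instance] ColimitWeight.addCommGroup

section Limits

variable {J : Type u₁} [DGCategory.{v₁} J] {C : Type u₂} [DGCategory.{v₂} C]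
  {E : Type u₃} [DGCategory.{v₃} E]

/-- A `W`-weighted cone over `F` with apex `pt`: a dg-natural transformation of degree `0` and
with zero differential `W → C(pt, F -)`. -/
structure WeightedCone (W : LimitWeight.{v₁, u₁, w} J) (F : DGFunctor J C) where
  pt : C
  leg : ∀ {j : J} {n : ℤ}, W.obj j n → Hom pt (F.obj j) n
  leg_add : ∀ {j : J} {n : ℤ} (w w' : W.obj j n), leg (w + w') = leg w + leg w'
  leg_d : ∀ {j : J} {n m : ℤ} (h : m + 1 = n) (w : W.obj j n), leg (W.d h w) = D h (leg w)
  leg_act : ∀ {i j : J} {n m p : ℤ} (x : Hom i j n) (w : W.obj i m) (h : n + m = p),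
    leg (W.act x w h) = DGCategory.comp (F.map x) (leg w) h

/-- The elements of degree `n` of the complex of dg-natural transformations `W → C(X, F -)`. -/
structure IsWeightHom (W : LimitWeight.{v₁, u₁, w} J) (F : DGFunctor J C) (X : C) (n : ℤ)
    (φ : ∀ (j : J) (k : ℤ), W.obj j k → Hom X (F.obj j) (n + k)) : Prop where
  map_add : ∀ (j : J) (k : ℤ) (w w' : W.obj j k), φ j k (w + w') = φ j k w + φ j k w'
  map_act : ∀ {i j : J} {m k p : ℤ} (x : Hom i j m) (w : W.obj i k) (h : m + k = p)
    (h' : m + (n + k) = n + p),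
    φ j p (W.act x w h) = (n * m).negOnePow • DGCategory.comp (F.map x) (φ i k w) h'

/-- A weighted cone is a limit cone if the induced chain maps `C(X, pt) → [J, Ch](W, C(X, F -))`,
`x ↦ (w ↦ (-1)^(|x| |w|) leg w ∘ x)`, are isomorphisms, i.e. bijective in every degree. -/
def WeightedCone.IsLimit {W : LimitWeight.{v₁, u₁, w} J} {F : DGFunctor J C}
    (c : WeightedCone W F) : Prop :=
  ∀ (X : C) (n : ℤ) (φ : ∀ (j : J) (k : ℤ), W.obj j k → Hom X (F.obj j) (n + k)),
    IsWeightHom W F X n φ → ∃! x : Hom X c.pt n, ∀ (j : J) (k : ℤ) (w : W.obj j k),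
      φ j k w = (n * k).negOnePow • DGCategory.comp (c.leg w) x (add_comm k n)

/-- The weighted limit `{W, F}` exists. -/
def HasWeightedLimit (W : LimitWeight.{v₁, u₁, w} J) (F : DGFunctor J C) : Prop :=
  ∃ c : WeightedCone W F, c.IsLimit

/-- The image of a weighted cone under a dg-functor. -/
def DGFunctor.mapCone (Φ : DGFunctor C E) {W : LimitWeight.{v₁, u₁, w} J} {F : DGFunctor J C}
    (c : WeightedCone W F) : WeightedCone W (Φ.comp F) where
  pt := Φ.obj c.pt
  leg w := Φ.map (c.leg w)
  leg_add w w' := by rw [c.leg_add, Φ.isDGFunctor.map_add]; rfl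
  leg_d h w := by rw [c.leg_d, Φ.isDGFunctor.map_D]; rfl
  leg_act x w h := by rw [c.leg_act, Φ.isDGFunctor.map_comp]; rfl

/-- A `W`-weighted cocone under `F` with apex `pt`: a dg-natural transformation of degree `0` and
with zero differential `W → C(F -, pt)`. -/
structure WeightedCocone (W : ColimitWeight.{v₁, u₁, w} J) (F : DGFunctor J C) where
  pt : C
  leg : ∀ {j : J} {n : ℤ}, W.obj j n → Hom (F.obj j) pt n
  leg_add : ∀ {j : J} {n : ℤ} (w w' : W.obj j n), leg (w + w') = leg w + leg w'
  leg_d : ∀ {j : J} {n m : ℤ} (h : m + 1 = n) (w : W.obj j n), leg (W.d h w) = D h (leg w)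
  leg_act : ∀ {i j : J} {n m p : ℤ} (w : W.obj j n) (x : Hom i j m) (h : n + m = p),
    leg (W.act w x h) = DGCategory.comp (leg w) (F.map x) h

/-- The elements of degree `n` of the complex of dg-natural transformations `W → C(F -, X)`. -/
structure IsCoweightHom (W : ColimitWeight.{v₁, u₁, w} J) (F : DGFunctor J C) (X : C) (n : ℤ)
    (φ : ∀ (j : J) (k : ℤ), W.obj j k → Hom (F.obj j) X (n + k)) : Prop where
  map_add : ∀ (j : J) (k : ℤ) (w w' : W.obj j k), φ j k (w + w') = φ j k w + φ j k w'
  map_act : ∀ {i j : J} {k m p : ℤ} (w : W.obj j k) (x : Hom i j m) (h : k + m = p)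
    (h' : (n + k) + m = n + p),
    φ i p (W.act w x h) = DGCategory.comp (φ j k w) (F.map x) h'

/-- A weighted cocone is a colimit cocone if the induced chain maps
`C(pt, X) → [Jᵒᵖ, Ch](W, C(F -, X))`, `x ↦ (w ↦ x ∘ leg w)`, are isomorphisms, i.e. bijective in
every degree. -/
def WeightedCocone.IsColimit {W : ColimitWeight.{v₁, u₁, w} J} {F : DGFunctor J C}
    (c : WeightedCocone W F) : Prop :=
  ∀ (X : C) (n : ℤ) (φ : ∀ (j : J) (k : ℤ), W.obj j k → Hom (F.obj j) X (n + k)),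
    IsCoweightHom W F X n φ → ∃! x : Hom c.pt X n, ∀ (j : J) (k : ℤ) (w : W.obj j k),
      φ j k w = DGCategory.comp x (c.leg w) rfl

/-- The weighted colimit `W * F` exists. -/
def HasWeightedColimit (W : ColimitWeight.{v₁, u₁, w} J) (F : DGFunctor J C) : Prop :=
  ∃ c : WeightedCocone W F, c.IsColimit

/-- The image of a weighted cocone under a dg-functor. -/
def DGFunctor.mapCocone (Φ : DGFunctor C E) {W : ColimitWeight.{v₁, u₁, w} J}
    {F : DGFunctor J C} (c : WeightedCocone W F) : WeightedCocone W (Φ.comp F) where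
  pt := Φ.obj c.pt
  leg w := Φ.map (c.leg w)
  leg_add w w' := by rw [c.leg_add, Φ.isDGFunctor.map_add]; rfl
  leg_d h w := by rw [c.leg_d, Φ.isDGFunctor.map_D]; rfl
  leg_act w x h := by rw [c.leg_act, Φ.isDGFunctor.map_comp]; rfl

end Limits

/-! ## dg-categories given by generators and relations -/

/-- Formal expressions in generators `G`: the raw terms of the free dg-category on `G`. -/
inductive PreHom {Ob : Type} (G : Ob → Ob → ℤ → Type) : Ob → Ob → ℤ → Type
  | of {a b : Ob} {n : ℤ} (x : G a b n) : PreHom G a b n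
  | id (a : Ob) : PreHom G a a 0
  | comp {a b c : Ob} {n m p : ℤ} (y : PreHom G b c n) (x : PreHom G a b m) (h : n + m = p) :
      PreHom G a c p
  | D {a b : Ob} {n m : ℤ} (h : m + 1 = n) (x : PreHom G a b n) : PreHom G a b m
  | zero {a b : Ob} {n : ℤ} : PreHom G a b n
  | add {a b : Ob} {n : ℤ} (x y : PreHom G a b n) : PreHom G a b n
  | neg {a b : Ob} {n : ℤ} (x : PreHom G a b n) : PreHom G a b n

namespace PreHom

variable {Ob : Type} {G : Ob → Ob → ℤ → Type}

/-- The expression `(-1)^k x`. -/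
def signed (k : ℤ) {a b : Ob} {n : ℤ} (x : PreHom G a b n) : PreHom G a b n :=
  if Even k then x else neg x

/-- The congruence on formal expressions generated by the axioms of a dg-category and by the given
relations `R` (its equivalence closure is taken when passing to the quotient). -/
inductive Rel (R : ∀ {a b : Ob} {n : ℤ}, PreHom G a b n → PreHom G a b n → Prop) :
    ∀ {a b : Ob} {n : ℤ}, PreHom G a b n → PreHom G a b n → Prop
  | of_rel {a b : Ob} {n : ℤ} {x y : PreHom G a b n} (h : R x y) : Rel R x y
  -- congruence
  | congr_comp_left {a b c : Ob} {n m p : ℤ} {y y' : PreHom G b c n} (x : PreHom G a b m)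
      (h : n + m = p) : Rel R y y' → Rel R (comp y x h) (comp y' x h)
  | congr_comp_right {a b c : Ob} {n m p : ℤ} (y : PreHom G b c n) {x x' : PreHom G a b m}
      (h : n + m = p) : Rel R x x' → Rel R (comp y x h) (comp y x' h)
  | congr_D {a b : Ob} {n m : ℤ} (h : m + 1 = n) {x x' : PreHom G a b n} :
      Rel R x x' → Rel R (D h x) (D h x')
  | congr_add_left {a b : Ob} {n : ℤ} {x x' : PreHom G a b n} (y : PreHom G a b n) :
      Rel R x x' → Rel R (add x y) (add x' y)
  | congr_add_right {a b : Ob} {n : ℤ} (x : PreHom G a b n) {y y' : PreHom G a b n} :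
      Rel R y y' → Rel R (add x y) (add x y')
  | congr_neg {a b : Ob} {n : ℤ} {x x' : PreHom G a b n} : Rel R x x' → Rel R (neg x) (neg x')
  -- abelian groups
  | add_assoc {a b : Ob} {n : ℤ} (x y z : PreHom G a b n) :
      Rel R (add (add x y) z) (add x (add y z))
  | add_comm {a b : Ob} {n : ℤ} (x y : PreHom G a b n) : Rel R (add x y) (add y x)
  | zero_add {a b : Ob} {n : ℤ} (x : PreHom G a b n) : Rel R (add zero x) x
  | neg_add {a b : Ob} {n : ℤ} (x : PreHom G a b n) : Rel R (add (neg x) x) zero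
  -- categories
  | add_comp {a b c : Ob} {n m p : ℤ} (y y' : PreHom G b c n) (x : PreHom G a b m)
      (h : n + m = p) : Rel R (comp (add y y') x h) (add (comp y x h) (comp y' x h))
  | comp_add {a b c : Ob} {n m p : ℤ} (y : PreHom G b c n) (x x' : PreHom G a b m)
      (h : n + m = p) : Rel R (comp y (add x x') h) (add (comp y x h) (comp y x' h))
  | id_comp {a b : Ob} {n : ℤ} (x : PreHom G a b n) (h : 0 + n = n) : Rel R (comp (id b) x h) x
  | comp_id {a b : Ob} {n : ℤ} (x : PreHom G a b n) (h : n + 0 = n) : Rel R (comp x (id a) h) x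
  | assoc {a b c d : Ob} {k n m p q r : ℤ} (z : PreHom G c d k) (y : PreHom G b c n)
      (x : PreHom G a b m) (hp : k + n = p) (hq : n + m = q) (hr : p + m = r) (hr' : k + q = r) :
      Rel R (comp (comp z y hp) x hr) (comp z (comp y x hq) hr')
  -- differentials
  | D_add {a b : Ob} {n m : ℤ} (h : m + 1 = n) (x y : PreHom G a b n) :
      Rel R (D h (add x y)) (add (D h x) (D h y))
  | D_D {a b : Ob} {n m k : ℤ} (h : m + 1 = n) (h' : k + 1 = m) (x : PreHom G a b n) :
      Rel R (D h' (D h x)) zero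
  | D_id (a : Ob) {m : ℤ} (h : m + 1 = 0) : Rel R (D h (id a)) zero
  | D_comp {a b c : Ob} {n m p n' m' p' : ℤ} (y : PreHom G b c n) (x : PreHom G a b m)
      (h : n + m = p) (hn : n' + 1 = n) (hm : m' + 1 = m) (hp : p' + 1 = p) (h₁ : n' + m = p')
      (h₂ : n + m' = p') :
      Rel R (D hp (comp y x h)) (add (comp (D hn y) x h₁) (signed n (comp y (D hm x) h₂)))

end PreHom

section Presentation

variable {Ob : Type} (G : Ob → Ob → ℤ → Type)
  (R : ∀ {a b : Ob} {n : ℤ}, PreHom G a b n → PreHom G a b n → Prop)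

/-- Morphisms of the dg-category with generators `G` and relations `R`. -/
def PresHom (a b : Ob) (n : ℤ) : Type := Quot (PreHom.Rel (a := a) (b := b) (n := n) R)

/-- The morphism represented by a formal expression. -/
def PresHom.mk {a b : Ob} {n : ℤ} (x : PreHom G a b n) : PresHom G R a b n := Quot.mk _ x

instance (a b : Ob) (n : ℤ) : Zero (PresHom G R a b n) := ⟨Quot.mk _ .zero⟩

instance (a b : Ob) (n : ℤ) : Add (PresHom G R a b n) :=
  ⟨Quot.map₂ PreHom.add (fun x _ _ h => .congr_add_right x h)
    (fun _ _ y h => .congr_add_left y h)⟩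

instance (a b : Ob) (n : ℤ) : Neg (PresHom G R a b n) :=
  ⟨Quot.map PreHom.neg fun _ _ h => .congr_neg h⟩

instance presHomAddCommGroup (a b : Ob) (n : ℤ) : AddCommGroup (PresHom G R a b n) where
  nsmul := nsmulRec
  zsmul := zsmulRec
  add_assoc := by rintro ⟨x⟩ ⟨y⟩ ⟨z⟩; exact Quot.sound (.add_assoc x y z)
  add_comm := by rintro ⟨x⟩ ⟨y⟩; exact Quot.sound (.add_comm x y)
  zero_add := by rintro ⟨x⟩; exact Quot.sound (.zero_add x)
  add_zero := by
    rintro ⟨x⟩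
    exact (Quot.sound (.add_comm x .zero)).trans (Quot.sound (.zero_add x))
  neg_add_cancel := by rintro ⟨x⟩; exact Quot.sound (.neg_add x)

lemma presHom_signed {a b : Ob} {n : ℤ} (k : ℤ) (x : PreHom G a b n) :
    PresHom.mk G R (x.signed k) = k.negOnePow • PresHom.mk G R x := by
  unfold PreHom.signed
  split_ifs with hk
  · rw [Int.negOnePow_even k hk, one_smul]
  · rw [Int.negOnePow_odd k (Int.not_even_iff_odd.mp hk), Units.neg_smul, one_smul]; rfl

/-- The dg-category with generators `G` and relations `R`. -/
@[reducible] def presentedDGCategory : DGCategory.{0} Ob where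
  Hom a b n := PresHom G R a b n
  addCommGroupHom a b n := presHomAddCommGroup G R a b n
  id a := Quot.mk _ (.id a)
  comp y x h := Quot.map₂ (fun y x => PreHom.comp y x h) (fun y _ _ r => .congr_comp_right y h r)
    (fun _ _ x r => .congr_comp_left x h r) y x
  D h := Quot.map (PreHom.D h) fun _ _ r => .congr_D h r
  add_comp := by rintro _ _ _ _ _ _ ⟨y⟩ ⟨z⟩ ⟨x⟩ h; exact Quot.sound (.add_comp y z x h)
  comp_add := by rintro _ _ _ _ _ _ ⟨y⟩ ⟨x⟩ ⟨z⟩ h; exact Quot.sound (.comp_add y x z h)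
  id_comp := by rintro _ _ _ ⟨x⟩ h; exact Quot.sound (.id_comp x h)
  comp_id := by rintro _ _ _ ⟨x⟩ h; exact Quot.sound (.comp_id x h)
  assoc := by
    rintro _ _ _ _ _ _ _ _ _ _ ⟨z⟩ ⟨y⟩ ⟨x⟩ hp hq hr hr'
    exact Quot.sound (.assoc z y x hp hq hr hr')
  D_add := by rintro _ _ _ _ h ⟨x⟩ ⟨y⟩; exact Quot.sound (.D_add h x y)
  D_D := by rintro _ _ _ _ _ h h' ⟨x⟩; exact Quot.sound (.D_D h h' x)
  D_id := by intro a m h; exact Quot.sound (.D_id a h)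
  D_comp := by
    rintro _ _ _ _ _ _ _ _ _ ⟨y⟩ ⟨x⟩ h hn hm hp h₁ h₂
    exact (Quot.sound (.D_comp y x h hn hm hp h₁ h₂)).trans
      (congrArg (fun z => PresHom.mk G R (.comp (.D hn y) x h₁) + z)
        (presHom_signed G R _ (.comp y (.D hm x) h₂)))

end Presentation

section Lift

variable {Ob : Type} {G : Ob → Ob → ℤ → Type}
  {R : ∀ {a b : Ob} {n : ℤ}, PreHom G a b n → PreHom G a b n → Prop}
  {C : Type u} [DGCategory.{v} C] (obj : Ob → C)
  (gen : ∀ {a b : Ob} {n : ℤ}, G a b n → Hom (obj a) (obj b) n)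

/-- The value of a formal expression in a dg-category. -/
def PreHom.eval : ∀ {a b : Ob} {n : ℤ}, PreHom G a b n → Hom (obj a) (obj b) n
  | _, _, _, .of x => gen x
  | _, _, _, .id a => DGCategory.id (obj a)
  | _, _, _, .comp y x h => DGCategory.comp (PreHom.eval y) (PreHom.eval x) h
  | _, _, _, .D h x => DGCategory.D h (PreHom.eval x)
  | _, _, _, .zero => 0
  | _, _, _, .add x y => PreHom.eval x + PreHom.eval y
  | _, _, _, .neg x => - PreHom.eval x

lemma PreHom.eval_signed (k : ℤ) {a b : Ob} {n : ℤ} (x : PreHom G a b n) :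
    (x.signed k).eval obj gen = k.negOnePow • x.eval obj gen := by
  unfold PreHom.signed
  split_ifs with hk
  · rw [Int.negOnePow_even k hk, one_smul]
  · rw [Int.negOnePow_odd k (Int.not_even_iff_odd.mp hk), Units.neg_smul, one_smul]; rfl

lemma PreHom.eval_eq_of_rel
    (hR : ∀ {a b : Ob} {n : ℤ} {x y : PreHom G a b n}, R x y → x.eval obj gen = y.eval obj gen)
    {a b : Ob} {n : ℤ} {x y : PreHom G a b n} (h : PreHom.Rel R x y) :
    x.eval obj gen = y.eval obj gen := by
  induction h with
  | of_rel h => exact hR h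
  | congr_comp_left x h _ ih => exact congrArg (fun z => DGCategory.comp z _ h) ih
  | congr_comp_right y h _ ih => exact congrArg (fun z => DGCategory.comp _ z h) ih
  | congr_D h _ ih => exact congrArg (DGCategory.D h) ih
  | congr_add_left y _ ih => exact congrArg (fun z => z + _) ih
  | congr_add_right x _ ih => exact congrArg (fun z => _ + z) ih
  | congr_neg _ ih => exact congrArg (fun z => -z) ih
  | add_assoc x y z => exact _root_.add_assoc _ _ _
  | add_comm x y => exact _root_.add_comm _ _
  | zero_add x => exact _root_.zero_add _
  | neg_add x => exact neg_add_cancel _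
  | add_comp y y' x h => exact DGCategory.add_comp _ _ _ h
  | comp_add y x x' h => exact DGCategory.comp_add _ _ _ h
  | id_comp x h => exact DGCategory.id_comp _ h
  | comp_id x h => exact DGCategory.comp_id _ h
  | assoc z y x hp hq hr hr' => exact DGCategory.assoc _ _ _ hp hq hr hr'
  | D_add h x y => exact DGCategory.D_add h _ _
  | D_D h h' x => exact DGCategory.D_D h h' _
  | D_id a h => exact DGCategory.D_id _ h
  | D_comp y x h hn hm hp h₁ h₂ =>
    exact (DGCategory.D_comp _ _ h hn hm hp h₁ h₂).trans
      (congrArg (fun z => _ + z) (PreHom.eval_signed obj gen _ (.comp y (.D hm x) h₂)).symm)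

/-- The dg-functor out of a presented dg-category determined by images of the generators that
satisfy the relations. -/
def presentedLift
    (hR : ∀ {a b : Ob} {n : ℤ} {x y : PreHom G a b n}, R x y → x.eval obj gen = y.eval obj gen) :
    @DGFunctor Ob (presentedDGCategory G R) C _ :=
  letI := presentedDGCategory G R
  { obj := obj
    map := Quot.lift (PreHom.eval obj gen) fun _ _ r => PreHom.eval_eq_of_rel obj gen hR r
    isDGFunctor :=
      { map_add := by rintro _ _ _ ⟨x⟩ ⟨y⟩; rfl
        map_id := fun _ => rfl
        map_comp := by rintro _ _ _ _ _ _ ⟨y⟩ ⟨x⟩ h; rfl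
        map_D := by rintro _ _ _ _ h ⟨x⟩; rfl } }

end Lift

/-! ## Perturbations -/

section Perturbations

variable {C : Type u} [DGCategory.{v} C]

/-- The Maurer-Cartan equation `D δ = -δ²`. -/
def IsMaurerCartan {A : C} (δ : Hom A A (-1)) : Prop :=
  D (n := -1) (m := -2) rfl δ = - comp (p := -2) δ δ rfl

/-- A `δ`-perturbation of `A`: an object `A_δ` with a map `φ : A_δ → A` of degree `0` inducing
isomorphisms of complexes `φ_* : C(B, A_δ) ≅ C(B, A)_{δ_*}`, where the latter is `C(B, A)` with
differential `D + δ_*`. -/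
structure Perturbation (A : C) (δ : Hom A A (-1)) where
  obj : C
  φ : Hom obj A 0
  bijective : ∀ (B : C) (n : ℤ),
    Function.Bijective fun x : Hom B obj n => (comp φ x (zero_add n) : Hom B A n)
  map_D : ∀ {B : C} {n m : ℤ} (h : m + 1 = n) (h' : -1 + n = m) (x : Hom B obj n),
    comp φ (D h x) (zero_add m) =
      D h (comp φ x (zero_add n)) + comp δ (comp φ x (zero_add n)) h'

/-- A choice of a perturbation `A_δ` for every object `A` and every solution `δ` of the
Maurer-Cartan equation on `A`. It exists precisely if `C` is closed under perturbations. -/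
abbrev ChosenPerturbations (C : Type u) [DGCategory.{v} C] :=
  ∀ (A : C) (δ : Hom A A (-1)), IsMaurerCartan δ → Perturbation A δ

namespace Perturbation

variable {A B E : C} {δ : Hom A A (-1)} {ε : Hom B B (-1)} {η : Hom E E (-1)}

lemma exists_inverse (P : Perturbation A δ) :
    ∃ ψ : Hom A P.obj 0, comp (p := 0) P.φ ψ rfl = DGCategory.id A :=
  (P.bijective A 0).2 (DGCategory.id A)

/-- The inverse `ψ : A → A_δ` of `φ : A_δ → A`. -/
noncomputable def ψ (P : Perturbation A δ) : Hom A P.obj 0 := P.exists_inverse.choose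

lemma φ_ψ (P : Perturbation A δ) : comp (p := 0) P.φ P.ψ rfl = DGCategory.id A :=
  P.exists_inverse.choose_spec

lemma φ_inj (P : Perturbation A δ) {X : C} {n : ℤ} (h : 0 + n = n) {x y : Hom X P.obj n}
    (e : comp P.φ x h = comp P.φ y h) : x = y := (P.bijective X n).1 e

lemma ψ_φ (P : Perturbation A δ) : comp (p := 0) P.ψ P.φ rfl = DGCategory.id P.obj := by
  apply P.φ_inj rfl
  rw [← assoc P.φ P.ψ P.φ (p := 0) rfl rfl rfl rfl, φ_ψ, DGCategory.id_comp, DGCategory.comp_id]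

lemma D_φ (P : Perturbation A δ) : D (n := 0) (m := -1) rfl P.φ = - comp (p := -1) δ P.φ rfl := by
  have h := P.map_D (n := 0) (m := -1) rfl rfl (DGCategory.id P.obj)
  rw [DGCategory.D_id, comp_zero, DGCategory.comp_id] at h
  exact eq_neg_of_add_eq_zero_left h.symm

lemma D_ψ (P : Perturbation A δ) : D (n := 0) (m := -1) rfl P.ψ = comp (p := -1) P.ψ δ rfl := by
  apply P.φ_inj rfl
  rw [P.map_D (n := 0) (m := -1) rfl rfl, P.φ_ψ, DGCategory.D_id, zero_add, DGCategory.comp_id,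
    ← assoc P.φ P.ψ δ (p := 0) rfl rfl rfl rfl, φ_ψ, DGCategory.id_comp]

/-- The transfer `ψ ∘ x ∘ φ : A_δ → B_ε` of `x : A → B`. -/
noncomputable def transfer (P : Perturbation A δ) (Q : Perturbation B ε) {n : ℤ} (x : Hom A B n) :
    Hom P.obj Q.obj n :=
  comp Q.ψ (comp x P.φ (add_zero n)) (zero_add n)

variable (P : Perturbation A δ) (Q : Perturbation B ε) (T : Perturbation E η)

lemma transfer_add {n : ℤ} (x y : Hom A B n) :
    P.transfer Q (x + y) = P.transfer Q x + P.transfer Q y := by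
  simp only [transfer, add_comp, comp_add]

lemma transfer_neg {n : ℤ} (x : Hom A B n) : P.transfer Q (-x) = - P.transfer Q x := by
  simp only [transfer, neg_comp, comp_neg]

lemma transfer_sub {n : ℤ} (x y : Hom A B n) :
    P.transfer Q (x - y) = P.transfer Q x - P.transfer Q y := by
  simp only [transfer, sub_comp, comp_sub]

lemma transfer_zero {n : ℤ} : P.transfer Q (0 : Hom A B n) = 0 := by
  simp only [transfer, zero_comp, comp_zero]

lemma transfer_id : P.transfer P (DGCategory.id A) = DGCategory.id P.obj := by
  rw [transfer, DGCategory.id_comp, ψ_φ]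

lemma transfer_comp {n m p : ℤ} (y : Hom B E n) (x : Hom A B m) (h : n + m = p) :
    P.transfer T (comp y x h) = comp (Q.transfer T y) (P.transfer Q x) h := by
  unfold transfer
  rw [assoc T.ψ _ _ _ (q := p) h _ (zero_add p),
    assoc y Q.φ _ (add_zero n) (q := m) (zero_add m) h h,
    ← assoc Q.φ Q.ψ _ (p := 0) rfl (zero_add m) (zero_add m) (zero_add m), φ_ψ,
    DGCategory.id_comp, assoc y x P.φ h (add_zero m) (add_zero p) h]

lemma D_transfer {n m : ℤ} (h : m + 1 = n) (h₁ : -1 + n = m) (h₂ : n + -1 = m) (x : Hom A B n) :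
    D h (P.transfer Q x) =
      P.transfer Q (D h x + comp ε x h₁ - n.negOnePow • comp x δ h₂) := by
  unfold transfer
  rw [DGCategory.D_comp Q.ψ _ _ (n' := -1) rfl h h h₁ (zero_add m), D_ψ,
    DGCategory.D_comp x P.φ _ h (m' := -1) rfl h (add_zero m) h₂, D_φ,
    assoc Q.ψ ε _ rfl (q := m) h₁ h₁ (zero_add m),
    ← assoc ε x P.φ (p := m) h₁ (add_zero n) (add_zero m) h₁, comp_neg,
    ← assoc x δ P.φ (p := m) h₂ rfl (add_zero m) h₂]
  simp only [Int.negOnePow_zero, one_smul, sub_comp, add_comp, comp_add, comp_sub, sign_comp,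
    comp_sign, smul_neg, comp_neg]
  abel

end Perturbation

/-! ## Strong deformation retractions and the perturbation lemma -/

/-- `(f, g, h)` is a strong deformation retraction of `A` onto `B`. -/
structure IsSDR {A B : C} (f : Hom A B 0) (g : Hom B A 0) (h : Hom A A 1) : Prop where
  D_f : D (n := 0) (m := -1) rfl f = 0
  D_g : D (n := 0) (m := -1) rfl g = 0
  D_h : D (n := 1) (m := 0) rfl h = DGCategory.id A - comp (p := 0) g f rfl
  f_g : comp (p := 0) f g rfl = DGCategory.id B
  f_h : comp (p := 1) f h rfl = 0
  h_g : comp (p := 1) h g rfl = 0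
  h_h : comp (p := 2) h h rfl = 0

/-- `ι` is an inverse of `1 + δ h`. -/
structure IsLocalized {A : C} (h : Hom A A 1) (δ : Hom A A (-1)) (ι : Hom A A 0) : Prop where
  right : comp (p := 0) (DGCategory.id A + comp (p := 0) δ h rfl) ι rfl = DGCategory.id A
  left : comp (p := 0) ι (DGCategory.id A + comp (p := 0) δ h rfl) rfl = DGCategory.id A

section PerturbationLemma

variable {A B : C} (f : Hom A B 0) (g : Hom B A 0) (h : Hom A A 1) (δ : Hom A A (-1))
  (ι : Hom A A 0)

/-- `f (1 + δ h)⁻¹`. -/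
def hatF : Hom A B 0 := comp f ι rfl

/-- `(1 + h δ)⁻¹ = 1 - h (1 + δ h)⁻¹ δ`. -/
def hatInv : Hom A A 0 := DGCategory.id A - comp (p := 0) h (comp (p := -1) ι δ rfl) rfl

/-- `(1 + h δ)⁻¹ g`. -/
def hatG : Hom B A 0 := comp (hatInv h δ ι) g rfl

/-- `h (1 + δ h)⁻¹`. -/
def hatH : Hom A A 1 := comp h ι rfl

/-- The perturbation `f (1 + δ h)⁻¹ δ g` of the target. -/
def hatδ : Hom B B (-1) := comp (p := -1) (hatF f ι) (comp (p := -1) δ g rfl) rfl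


variable {f g h δ ι}

lemma IsSDR.fg {X : C} (S : IsSDR f g h) {n : ℤ} (x : Hom X B n) (e₁ e₂ : 0 + n = n) :
    comp f (comp g x e₁) e₂ = x := by
  rw [← assoc f g x (p := 0) rfl e₁ e₂ e₂, S.f_g, DGCategory.id_comp]

lemma IsSDR.fh {X : C} (S : IsSDR f g h) {n m p : ℤ} (x : Hom X A n) (e₁ : 1 + n = m)
    (e₂ : 0 + m = p) : comp f (comp h x e₁) e₂ = 0 := by
  rw [← assoc f h x (p := 1) rfl e₁ (by lia) e₂, S.f_h, zero_comp]

lemma IsSDR.hg {X : C} (S : IsSDR f g h) {n m p : ℤ} (x : Hom X B n) (e₁ : 0 + n = m)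
    (e₂ : 1 + m = p) : comp h (comp g x e₁) e₂ = 0 := by
  rw [← assoc h g x (p := 1) rfl e₁ (by lia) e₂, S.h_g, zero_comp]

lemma IsSDR.hh {X : C} (S : IsSDR f g h) {n m p : ℤ} (x : Hom X A n) (e₁ : 1 + n = m)
    (e₂ : 1 + m = p) : comp h (comp h x e₁) e₂ = 0 := by
  rw [← assoc h h x (p := 2) rfl e₁ (by lia) e₂, S.h_h, zero_comp]

lemma assoc_right {X Y Z T : C} {k n m p q r : ℤ} (a : Hom Z T k) (b : Hom Y Z n) (c : Hom X Y m)
    {hp : k + n = p} {hr : p + m = r} (hq : n + m = q) :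
    comp (comp a b hp) c hr = comp a (comp b c hq) (by lia) := assoc _ _ _ _ _ _ _

/-- `δ h ι = 1 - ι`. -/
lemma IsLocalized.right_eq (L : IsLocalized h δ ι) :
    comp (p := 0) δ (comp (p := 1) h ι rfl) rfl = DGCategory.id A - ι := by
  have e := L.right
  rw [add_comp, DGCategory.id_comp, assoc δ h ι (q := 1) rfl rfl rfl rfl] at e
  rw [← e]; abel

/-- `ι δ h = 1 - ι`. -/
lemma IsLocalized.left_eq (L : IsLocalized h δ ι) :
    comp (p := 0) ι (comp (p := 0) δ h rfl) rfl = DGCategory.id A - ι := by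
  have e := L.left
  rw [comp_add, DGCategory.comp_id] at e
  rw [← e]; abel

lemma IsLocalized.ι_h (S : IsSDR f g h) (L : IsLocalized h δ ι) :
    comp (p := 1) ι h rfl = h := by
  have e := congrArg (fun x => comp (p := 1) x h rfl) L.left_eq
  simp only [sub_comp, DGCategory.id_comp] at e
  rw [assoc_right ι _ h (q := 1) rfl, assoc_right δ h h (q := 2) rfl, S.h_h,
    comp_zero, comp_zero] at e
  exact (sub_eq_zero.mp e.symm).symm

lemma IsLocalized.ι_g (S : IsSDR f g h) (L : IsLocalized h δ ι) :
    comp (p := 0) ι g rfl = g := by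
  have e := congrArg (fun x => comp (p := 0) x g rfl) L.left_eq
  simp only [sub_comp, DGCategory.id_comp] at e
  rw [assoc_right ι _ g (q := 0) rfl, assoc_right δ h g (q := 1) rfl, S.h_g,
    comp_zero, comp_zero] at e
  exact (sub_eq_zero.mp e.symm).symm

lemma IsLocalized.ιh {X : C} (S : IsSDR f g h) (L : IsLocalized h δ ι) {n m : ℤ} (x : Hom X A n)
    (e₁ : 1 + n = m) (e₂ : 0 + m = m) : comp ι (comp h x e₁) e₂ = comp h x e₁ := by
  rw [← assoc ι h x (p := 1) rfl e₁ e₁ e₂, L.ι_h S]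

lemma IsLocalized.ιg {X : C} (S : IsSDR f g h) (L : IsLocalized h δ ι) {n : ℤ} (x : Hom X B n)
    (e₁ e₂ : 0 + n = n) : comp ι (comp g x e₁) e₂ = comp g x e₁ := by
  rw [← assoc ι g x (p := 0) rfl e₁ e₁ e₂, L.ι_g S]

/-- `D (δ h) = -δ (1 + δ h) + δ g f`. -/
lemma D_δh (S : IsSDR f g h) (M : IsMaurerCartan δ) :
    D (n := 0) (m := -1) rfl (comp (p := 0) δ h rfl) =
      - comp (p := -1) δ (DGCategory.id A + comp (p := 0) δ h rfl) rfl
        + comp (p := -1) δ (comp (p := 0) g f rfl) rfl := by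
  rw [DGCategory.D_comp (p := 0) (p' := -1) δ h rfl (n' := -2) rfl (m' := 0) rfl rfl rfl rfl, M,
    S.D_h,
    Int.negOnePow_odd (-1) (by decide), Units.neg_smul, one_smul, neg_comp,
    assoc δ δ h (q := 0) rfl rfl rfl rfl, comp_sub, comp_add]
  abel

/-- `D ι = ι δ - ι δ g f ι`. -/
lemma IsLocalized.D_ι (S : IsSDR f g h) (M : IsMaurerCartan δ) (L : IsLocalized h δ ι) :
    D (n := 0) (m := -1) rfl ι = comp (p := -1) ι δ rfl -
      comp (p := -1) ι (comp (p := -1) δ (comp (p := 0) g (comp (p := 0) f ι rfl) rfl) rfl) rfl := by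
  set a := DGCategory.id A + comp (p := 0) δ h rfl with ha
  have Da : D (n := 0) (m := -1) rfl a = - comp (p := -1) δ a rfl
      + comp (p := -1) δ (comp (p := 0) g f rfl) rfl := by
    rw [ha, DGCategory.D_add, DGCategory.D_id, zero_add, D_δh S M]
  have e := congrArg (D (n := 0) (m := -1) rfl) L.left
  rw [DGCategory.D_id,
    DGCategory.D_comp (p := 0) (p' := -1) ι a rfl (n' := -1) rfl (m' := -1) rfl rfl rfl rfl,
    Int.negOnePow_zero, one_smul] at e
  have e' := congrArg (fun x => comp (p := -1) x ι rfl) e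
  simp only [add_comp, zero_comp] at e'
  rw [assoc_right _ a ι (q := 0) rfl, L.right, DGCategory.comp_id,
    assoc_right ι _ ι (q := -1) rfl, Da, add_comp, neg_comp,
    assoc_right δ a ι (q := 0) rfl, L.right, DGCategory.comp_id, comp_add, comp_neg,
    assoc_right δ _ ι (q := 0) rfl, assoc_right g f ι (q := 0) rfl] at e'
  rw [eq_neg_of_add_eq_zero_left e']
  abel

/-- `ĝ = g - h ι δ g`. -/
lemma hatG_eq : hatG g h δ ι =
    g - comp (p := 0) h (comp (p := -1) ι (comp (p := -1) δ g rfl) rfl) rfl := by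
  rw [hatG, hatInv, sub_comp, DGCategory.id_comp, assoc_right h _ g (q := -1) rfl,
    assoc_right ι δ g (q := -1) rfl]

lemma hatδ_eq : hatδ f g δ ι =
    comp (p := -1) f (comp (p := -1) ι (comp (p := -1) δ g rfl) rfl) rfl := by
  rw [hatδ, hatF, assoc_right f ι _ (q := -1) rfl]

/-- The perturbed differential of `f̂` vanishes. -/
lemma D_hatF (S : IsSDR f g h) (M : IsMaurerCartan δ) (L : IsLocalized h δ ι) :
    D (n := 0) (m := -1) rfl (hatF f ι) =
      comp (p := -1) (hatF f ι) δ rfl - comp (p := -1) (hatδ f g δ ι) (hatF f ι) rfl := by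
  rw [hatδ_eq]
  unfold hatF
  rw [DGCategory.D_comp (p := 0) (p' := -1) f ι rfl (n' := -1) rfl (m' := -1) rfl rfl rfl rfl,
    S.D_f, zero_comp,
    zero_add, Int.negOnePow_zero, one_smul, L.D_ι S M, comp_sub,
    assoc_right f ι δ (q := -1) rfl, assoc_right f _ _ (q := -1) rfl,
    assoc_right ι _ _ (q := -1) rfl, assoc_right δ g _ (q := 0) rfl]

/-- The perturbation of the target satisfies the Maurer-Cartan equation. -/
lemma isMaurerCartan_hatδ (S : IsSDR f g h) (M : IsMaurerCartan δ) (L : IsLocalized h δ ι) :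
    IsMaurerCartan (hatδ f g δ ι) := by
  have M' : D (n := -1) (m := -2) rfl δ = - comp (p := -2) δ δ rfl := M
  have e : hatδ f g δ ι = comp (p := -1) (hatF f ι) (comp (p := -1) δ g rfl) rfl := rfl
  have e₁ : D (n := -1) (m := -2) rfl (hatδ f g δ ι) =
      D (n := -1) (m := -2) rfl (comp (p := -1) (hatF f ι) (comp (p := -1) δ g rfl) rfl) := rfl
  unfold IsMaurerCartan
  rw [e₁, DGCategory.D_comp (n := 0) (m := -1) (p := -1) (p' := -2) _ _ rfl (n' := -1) rfl (m' := -2) rfl rfl rfl rfl, D_hatF S M L,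
    DGCategory.D_comp (p := -1) (p' := -2) δ g rfl (n' := -2) rfl (m' := -1) rfl rfl rfl rfl,
    S.D_g, comp_zero, smul_zero,
    add_zero (comp (p := -2) _ g rfl), M', Int.negOnePow_zero, one_smul, sub_comp, neg_comp,
    comp_neg,
    assoc_right _ δ (comp (p := -1) δ g rfl) (q := -2) rfl,
    assoc_right _ _ (comp (p := -1) δ g rfl) (q := -1) rfl, ← e,
    assoc_right δ δ g (q := -1) rfl]
  abel

/-- The perturbed differential of `ĝ` vanishes. -/
lemma D_hatG (S : IsSDR f g h) (M : IsMaurerCartan δ) (L : IsLocalized h δ ι) :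
    D (n := 0) (m := -1) rfl (hatG g h δ ι) =
      comp (p := -1) (hatG g h δ ι) (hatδ f g δ ι) rfl
        - comp (p := -1) δ (hatG g h δ ι) rfl := by
  have M' : D (n := -1) (m := -2) rfl δ = - comp (p := -2) δ δ rfl := M
  have key : comp (p := -1) δ (hatG g h δ ι) rfl =
      comp (p := -1) ι (comp (p := -1) δ g rfl) rfl := by
    have e := congrArg (fun x => comp (p := -1) x (comp (p := -1) δ g rfl) rfl) L.right_eq
    simp only [sub_comp, DGCategory.id_comp] at e
    rw [assoc_right δ _ _ (q := 0) rfl, assoc_right h _ _ (q := -1) rfl] at e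
    rw [hatG_eq, comp_sub, e]
    abel
  rw [key, hatδ_eq, hatG_eq, sub_comp, D_sub, S.D_g,
    DGCategory.D_comp (m := -1) (p := 0) (p' := -1) h _ rfl (n' := 0) rfl (m' := -2) rfl rfl rfl rfl,
    DGCategory.D_comp (m := -1) (p := -1) (p' := -2) ι _ rfl (n' := -1) rfl (m' := -2) rfl rfl rfl rfl,
    DGCategory.D_comp (p := -1) (p' := -2) δ g rfl (n' := -2) rfl (m' := -1) rfl rfl rfl rfl,
    S.D_h, S.D_g, M', L.D_ι S M, comp_zero, smul_zero,
    add_zero (comp (p := -2) _ g rfl),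
    Int.negOnePow_odd 1 (by decide), Units.neg_smul, one_smul, Int.negOnePow_zero, one_smul]
  simp only [sub_comp, comp_sub, neg_comp, comp_neg, comp_add, DGCategory.id_comp]
  rw [assoc_right g f _ (q := -1) rfl,
    assoc_right ι δ (comp (p := -1) δ g rfl) (q := -2) rfl,
    assoc_right δ δ g (q := -1) rfl,
    assoc_right ι _ (comp (p := -1) δ g rfl) (q := -2) rfl,
    assoc_right δ _ (comp (p := -1) δ g rfl) (q := -1) rfl,
    assoc_right g _ (comp (p := -1) δ g rfl) (q := -1) rfl,
    assoc_right f ι (comp (p := -1) δ g rfl) (q := -1) rfl,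
    assoc_right h _ _ (q := -2) rfl,
    assoc_right ι _ _ (q := -2) rfl,
    assoc_right δ g _ (q := -1) rfl]
  abel

/-- `ĥ` is a homotopy from `ĝ f̂` to the identity for the perturbed differential. -/
lemma D_hatH (S : IsSDR f g h) (M : IsMaurerCartan δ) (L : IsLocalized h δ ι) :
    D (n := 1) (m := 0) rfl (hatH h ι) =
      DGCategory.id A - comp (p := 0) (hatG g h δ ι) (hatF f ι) rfl
        - comp (p := 0) δ (hatH h ι) rfl - comp (p := 0) (hatH h ι) δ rfl := by
  unfold hatH hatF
  rw [L.right_eq, hatG_eq,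
    DGCategory.D_comp (p := 1) (p' := 0) h ι rfl (n' := 0) rfl (m' := -1) rfl rfl rfl rfl,
    S.D_h, L.D_ι S M, Int.negOnePow_odd 1 (by decide), Units.neg_smul, one_smul, comp_sub, sub_comp,
    sub_comp, DGCategory.id_comp, assoc_right g f ι (q := 0) rfl,
    assoc_right h ι δ (q := -1) rfl, assoc_right h _ _ (q := -1) rfl,
    assoc_right ι _ _ (q := -1) rfl, assoc_right δ g _ (q := 0) rfl]
  abel

lemma hatF_hatG (S : IsSDR f g h) (L : IsLocalized h δ ι) :
    comp (p := 0) (hatF f ι) (hatG g h δ ι) rfl = DGCategory.id B := by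
  rw [hatF, hatG_eq, comp_sub, assoc_right f ι _ (q := 0) rfl, L.ι_g S, S.f_g,
    assoc_right f ι _ (q := 0) rfl, L.ιh S, S.fh, sub_zero]

lemma hatF_hatH (S : IsSDR f g h) (L : IsLocalized h δ ι) :
    comp (p := 1) (hatF f ι) (hatH h ι) rfl = 0 := by
  rw [hatF, hatH, assoc_right f ι _ (q := 1) rfl, L.ιh S, S.fh]

lemma hatH_hatG (S : IsSDR f g h) (L : IsLocalized h δ ι) :
    comp (p := 1) (hatH h ι) (hatG g h δ ι) rfl = 0 := by
  rw [hatH, hatG_eq, comp_sub, assoc_right h ι _ (q := 0) rfl, L.ι_g S, S.h_g,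
    assoc_right h ι _ (q := 0) rfl, L.ιh S, S.hh, sub_zero]

lemma hatH_hatH (S : IsSDR f g h) (L : IsLocalized h δ ι) :
    comp (p := 2) (hatH h ι) (hatH h ι) rfl = 0 := by
  rw [hatH, assoc_right h ι _ (q := 1) rfl, L.ιh S, S.hh]

/-- The perturbation lemma: the maps `f̂`, `ĝ`, `ĥ`, transferred to the perturbed objects, form a
strong deformation retraction of `A_δ` onto `B_δ'`. -/
theorem IsSDR.perturb (S : IsSDR f g h) (M : IsMaurerCartan δ) (L : IsLocalized h δ ι)
    (P : Perturbation A δ) (Q : Perturbation B (hatδ f g δ ι)) :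
    IsSDR (P.transfer Q (hatF f ι)) (Q.transfer P (hatG g h δ ι)) (P.transfer P (hatH h ι)) where
  D_f := by
    rw [P.D_transfer Q (n := 0) (m := -1) rfl rfl rfl, D_hatF S M L, Int.negOnePow_zero, one_smul,
    sub_add_cancel,
      sub_self, Perturbation.transfer_zero]
  D_g := by
    rw [Q.D_transfer P (n := 0) (m := -1) rfl rfl rfl, D_hatG S M L, Int.negOnePow_zero, one_smul,
    sub_add_cancel,
      sub_self, Perturbation.transfer_zero]
  D_h := by
    rw [P.D_transfer P (n := 1) (m := 0) rfl rfl rfl, D_hatH S M L,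
    Int.negOnePow_odd 1 (by decide), Units.neg_smul,
      one_smul, sub_neg_eq_add, ← Perturbation.transfer_comp, ← P.transfer_id,
    ← Perturbation.transfer_sub]
    congr 1
    abel
  f_g := by rw [← Perturbation.transfer_comp, hatF_hatG S L, Perturbation.transfer_id]
  f_h := by rw [← Perturbation.transfer_comp, hatF_hatH S L, Perturbation.transfer_zero]
  h_g := by rw [← Perturbation.transfer_comp, hatH_hatG S L, Perturbation.transfer_zero]
  h_h := by rw [← Perturbation.transfer_comp, hatH_hatH S L, Perturbation.transfer_zero]

end PerturbationLemma

end Perturbations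

/-! ## The dg-categories `S` and `S_ps,loc` and the association -/

/-- The objects of `S`: the source `s` and the target `t`. -/
inductive SDR : Type
  | s | t

/-- The generators of `S`. -/
inductive SDRGen : SDR → SDR → ℤ → Type
  | f : SDRGen .s .t 0
  | g : SDRGen .t .s 0
  | h : SDRGen .s .s 1

namespace SDR

/-- The generator `f : s → t` as a formal expression. -/
abbrev f : PreHom SDRGen s t 0 := .of .f
/-- The generator `g : t → s` as a formal expression. -/
abbrev g : PreHom SDRGen t s 0 := .of .g
/-- The generator `h : s → s` as a formal expression. -/
abbrev h : PreHom SDRGen s s 1 := .of .h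

end SDR

open SDR in
/-- The relations of `S`: `D f = 0`, `D g = 0`, `D h = 1 - g f`, `f g = 1`, `f h = 0`, `h g = 0`,
`h h = 0`. -/
inductive SDRRel : ∀ {a b : SDR} {n : ℤ}, PreHom SDRGen a b n → PreHom SDRGen a b n → Prop
  | D_f : SDRRel (.D (m := -1) rfl f) .zero
  | D_g : SDRRel (.D (m := -1) rfl g) .zero
  | D_h : SDRRel (.D (m := 0) rfl h) (.add (.id s) (.neg (.comp (p := 0) g f rfl)))
  | f_g : SDRRel (.comp (p := 0) f g rfl) (.id t)
  | f_h : SDRRel (.comp (p := 1) f h rfl) .zero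
  | h_g : SDRRel (.comp (p := 1) h g rfl) .zero
  | h_h : SDRRel (.comp (p := 2) h h rfl) .zero

/-- The dg-category `S`; dg-functors `S → C` are the strong deformation retractions in `C`. -/
instance : DGCategory.{0} SDR := presentedDGCategory SDRGen SDRRel

/-- The objects of `S_ps,loc`: the source `s` and the target `t`. -/
inductive SDRPert : Type
  | s | t

/-- The generators of `S_ps,loc`. -/
inductive SDRPertGen : SDRPert → SDRPert → ℤ → Type
  | f : SDRPertGen .s .t 0
  | g : SDRPertGen .t .s 0
  | h : SDRPertGen .s .s 1
  | δ : SDRPertGen .s .s (-1)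
  | ι : SDRPertGen .s .s 0

namespace SDRPert

/-- The generator `f : s → t` as a formal expression. -/
abbrev f : PreHom SDRPertGen s t 0 := .of .f
/-- The generator `g : t → s` as a formal expression. -/
abbrev g : PreHom SDRPertGen t s 0 := .of .g
/-- The generator `h : s → s` as a formal expression. -/
abbrev h : PreHom SDRPertGen s s 1 := .of .h
/-- The perturbation `δ : s → s` as a formal expression. -/
abbrev δ : PreHom SDRPertGen s s (-1) := .of .δ
/-- The inverse `ι` of `1 + δ h` as a formal expression. -/
abbrev ι : PreHom SDRPertGen s s 0 := .of .ι

end SDRPert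

open SDRPert in
/-- The relations of `S_ps,loc`: those of `S`, the Maurer-Cartan equation `D δ = -δ²`, and `ι` is
inverse to `1 + δ h`. -/
inductive SDRPertRel :
    ∀ {a b : SDRPert} {n : ℤ}, PreHom SDRPertGen a b n → PreHom SDRPertGen a b n → Prop
  | D_f : SDRPertRel (.D (m := -1) rfl f) .zero
  | D_g : SDRPertRel (.D (m := -1) rfl g) .zero
  | D_h : SDRPertRel (.D (m := 0) rfl h) (.add (.id s) (.neg (.comp (p := 0) g f rfl)))
  | f_g : SDRPertRel (.comp (p := 0) f g rfl) (.id t)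
  | f_h : SDRPertRel (.comp (p := 1) f h rfl) .zero
  | h_g : SDRPertRel (.comp (p := 1) h g rfl) .zero
  | h_h : SDRPertRel (.comp (p := 2) h h rfl) .zero
  | D_δ : SDRPertRel (.D (m := -2) rfl δ) (.neg (.comp (p := -2) δ δ rfl))
  | right : SDRPertRel
      (.comp (p := 0) (.add (.id s) (.comp (p := 0) δ h rfl)) ι rfl) (.id s)
  | left : SDRPertRel
      (.comp (p := 0) ι (.add (.id s) (.comp (p := 0) δ h rfl)) rfl) (.id s)

/-- The dg-category `S_ps,loc`; dg-functors `S_ps,loc → C` are the strong deformation retractions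
in `C` with a perturbation `δ` of the source for which `1 + δ h` is invertible. -/
instance : DGCategory.{0} SDRPert := presentedDGCategory SDRPertGen SDRPertRel

namespace SDRPert

variable {C : Type u} [DGCategory.{v} C] (X : DGFunctor SDRPert C)

/-- The morphism of `S_ps,loc` represented by a formal expression. -/
abbrev mk {a b : SDRPert} {n : ℤ} (x : PreHom SDRPertGen a b n) : Hom a b n :=
  PresHom.mk SDRPertGen SDRPertRel x

/-- The value at a formal expression of a diagram of shape `S_ps,loc`. -/
abbrev val {a b : SDRPert} {n : ℤ} (x : PreHom SDRPertGen a b n) :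
    Hom (X.obj a) (X.obj b) n := X.map (mk x)

lemma val_rel {a b : SDRPert} {n : ℤ} {x y : PreHom SDRPertGen a b n} (r : SDRPertRel x y) :
    val X x = val X y := congrArg X.map (Quot.sound (.of_rel r))

lemma val_id (a : SDRPert) : val X (.id a) = DGCategory.id (X.obj a) := X.isDGFunctor.map_id a

lemma val_comp {a b c : SDRPert} {n m p : ℤ} (y : PreHom SDRPertGen b c n)
    (x : PreHom SDRPertGen a b m) (e : n + m = p) :
    val X (.comp y x e) = comp (val X y) (val X x) e :=
  X.isDGFunctor.map_comp (mk y) (mk x) e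

lemma val_D {a b : SDRPert} {n m : ℤ} (e : m + 1 = n) (x : PreHom SDRPertGen a b n) :
    val X (.D e x) = D e (val X x) := X.isDGFunctor.map_D e (mk x)

lemma val_zero {a b : SDRPert} {n : ℤ} : val X (.zero : PreHom SDRPertGen a b n) = 0 :=
  X.map_zero

lemma val_add {a b : SDRPert} {n : ℤ} (x y : PreHom SDRPertGen a b n) :
    val X (.add x y) = val X x + val X y := X.isDGFunctor.map_add (mk x) (mk y)

lemma val_neg {a b : SDRPert} {n : ℤ} (x : PreHom SDRPertGen a b n) :
    val X (.neg x) = - val X x := X.map_neg (mk x)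

lemma isSDR : IsSDR (val X f) (val X g) (val X h) where
  D_f := by simpa only [val_D, val_zero] using val_rel X .D_f
  D_g := by simpa only [val_D, val_zero] using val_rel X .D_g
  D_h := by
    simpa only [val_D, val_add, val_neg, val_id, val_comp, ← sub_eq_add_neg] using val_rel X .D_h
  f_g := by simpa only [val_comp, val_id] using val_rel X .f_g
  f_h := by simpa only [val_comp, val_zero] using val_rel X .f_h
  h_g := by simpa only [val_comp, val_zero] using val_rel X .h_g
  h_h := by simpa only [val_comp, val_zero] using val_rel X .h_h

lemma isMaurerCartan : IsMaurerCartan (val X δ) := by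
  unfold IsMaurerCartan
  simpa only [val_comp, val_D, val_neg] using val_rel X .D_δ

lemma isLocalized : IsLocalized (val X h) (val X δ) (val X ι) where
  right := by simpa only [val_comp, val_add, val_id] using val_rel X .right
  left := by simpa only [val_comp, val_add, val_id] using val_rel X .left

/-- The perturbation `δ' = f (1 + δ h)⁻¹ δ g` of the target. -/
def targetδ : Hom (X.obj t) (X.obj t) (-1) := hatδ (val X f) (val X g) (val X δ) (val X ι)

variable (P : ChosenPerturbations C)

/-- The chosen perturbation `A_δ` of the source. -/
def source : Perturbation (X.obj s) (val X δ) := P _ _ (isMaurerCartan X)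

/-- The chosen perturbation `B_δ'` of the target. -/
def target : Perturbation (X.obj t) (targetδ X) :=
  P _ _ (isMaurerCartan_hatδ (isSDR X) (isMaurerCartan X) (isLocalized X))

end SDRPert

section Association

variable {C : Type u} [DGCategory.{v} C]

/-- The images of the generators of `S` given by the maps of a strong deformation retraction. -/
def sdrGen {A B : C} (f : Hom A B 0) (g : Hom B A 0) (h : Hom A A 1) :
    ∀ {a b : SDR} {n : ℤ}, SDRGen a b n →
      Hom (SDR.casesOn (motive := fun _ => C) a A B) (SDR.casesOn (motive := fun _ => C) b A B) n
  | _, _, _, .f => f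
  | _, _, _, .g => g
  | _, _, _, .h => h

/-- The dg-functor `S → C` given by a strong deformation retraction. -/
def IsSDR.toDGFunctor {A B : C} {f : Hom A B 0} {g : Hom B A 0} {h : Hom A A 1}
    (S : IsSDR f g h) : DGFunctor SDR C :=
  presentedLift (R := SDRRel) (fun a => SDR.casesOn (motive := fun _ => C) a A B) (sdrGen f g h)
    (by
      intro a b n x y r
      cases r with
      | D_f => exact S.D_f
      | D_g => exact S.D_g
      | D_h => exact S.D_h.trans (sub_eq_add_neg _ _)
      | f_g => exact S.f_g
      | f_h => exact S.f_h
      | h_g => exact S.h_g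
      | h_h => exact S.h_h)

open SDRPert in
/-- The value of the association `[S_ps,loc, C] → [S, C]` on objects: a strong deformation
retraction `(f, g, h) : A → B` with a perturbation `δ` of `A` is sent to
`(f̂, ĝ, ĥ) : A_δ → B_δ'`, transferred to the perturbed objects. -/
noncomputable def perturb (P : ChosenPerturbations C) (X : DGFunctor SDRPert C) :
    DGFunctor SDR C :=
  ((isSDR X).perturb (isMaurerCartan X) (isLocalized X) (source X P) (target X P)).toDGFunctor

open SDRPert in
/-- The effect of the association on morphisms: `χ` is the image of the transformation
`φ : X → Y` if its components are those of `φ`, transferred to the perturbed objects. -/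
def IsPerturbed (P : ChosenPerturbations C) {X Y : DGFunctor SDRPert C} {n : ℤ} (φ : Hom X Y n)
    (χ : Hom (perturb P X) (perturb P Y) n) : Prop :=
  DGFunctor.app χ .s = (source X P).transfer (source Y P) (DGFunctor.app φ .s) ∧
    DGFunctor.app χ .t = (target X P).transfer (target Y P) (DGFunctor.app φ .t)

end Association

/-!
A dg-natural transformation `X → Y` between diagrams of shape `S_ps,loc` forms squares, commuting up
to the Koszul sign, with all five structure maps `f`, `g`, `h`, `δ`, `(1 + δ h)⁻¹`. Such squares
(`KoszulSquare`) are closed under sums and composites, so the components also form squares with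
`f̂`, `ĝ`, `ĥ` and `δ'`, which are noncommutative polynomials in the structure maps. The squares with
`f̂`, `ĝ`, `ĥ` say that the transferred components are natural on the generators of `S`; the squares
with `δ` and `δ'` say that transferring the components commutes with the differential
(`KoszulSquare.D_transfer`), because the two terms that distinguish the perturbed from the original
differential cancel. Since formal expressions in the generators may contain differentials,
naturality passes from the generators to all of `S` only if the differential of the transformation
is natural on the generators as well (`koszulSquare_of_gen`), which the previous point provides.

For limits, everything is compared with pointwise limits. If the values of a cone in a dg-category
of dg-functors are limit cones, then so is the cone (`WeightedCone.isLimit_of_eval`). If pointwise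
limits exist, they assemble to a dg-functor (`pointwiseLimit`), whose action on morphisms is the
unique one that forms squares with the legs; hence it is a limit, every other limit is isomorphic to
it, and so every limit is computed pointwise (`WeightedCone.IsLimit.eval`). Finally, the property of
being a limit cone refers to graded maps only, not to their differentials. The maps `φ : A_δ → A` of
the perturbations are isomorphisms of graded objects, and they identify the values of `Φ c` with
those of `c`; so if the latter are limit cones, the former are (`WeightedCone.IsLimit.of_iso`).
Colimits are dual.
-/

/-! ### Squares commuting up to the Koszul sign -/

/-- A square with vertical sides `α`, `β` of degree `n` and horizontal sides `x`, `x'` of degree `m`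
that commutes up to the Koszul sign: `β x = (-1)^(n m) x' α`. -/
def KoszulSquare {C : Type u} [DGCategory.{v} C] {A A' B B' : C} {n m : ℤ} (α : Hom A A' n)
    (β : Hom B B' n) (x : Hom A B m) (x' : Hom A' B' m) : Prop :=
  ∀ (p : ℤ) (h : n + m = p) (h' : m + n = p), comp β x h = (n * m).negOnePow • comp x' α h'

namespace KoszulSquare

variable {C : Type u} [DGCategory.{v} C] {A A' B B' E E' : C} {n m k p : ℤ}
  {α : Hom A A' n} {β : Hom B B' n} {γ : Hom E E' n}

lemma zero : KoszulSquare α β (0 : Hom A B m) 0 := by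
  intro p h h'
  rw [comp_zero, zero_comp, smul_zero]

lemma zero_sides (x : Hom A B m) (x' : Hom A' B' m) :
    KoszulSquare (0 : Hom A A' n) (0 : Hom B B' n) x x' := by
  intro p h h'
  rw [comp_zero, zero_comp, smul_zero]

lemma id : KoszulSquare α α (DGCategory.id A) (DGCategory.id A') := by
  intro p h h'
  obtain rfl : n = p := by lia
  rw [DGCategory.id_comp, DGCategory.comp_id, mul_zero, Int.negOnePow_zero, one_smul]

variable {x y : Hom A B m} {x' y' : Hom A' B' m}

lemma add (hx : KoszulSquare α β x x') (hy : KoszulSquare α β y y') :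
    KoszulSquare α β (x + y) (x' + y') := by
  intro p h h'
  rw [comp_add, add_comp, hx p h h', hy p h h', smul_add]

lemma neg (hx : KoszulSquare α β x x') : KoszulSquare α β (-x) (-x') := by
  intro p h h'
  rw [comp_neg, neg_comp, hx p h h', smul_neg]

lemma sub (hx : KoszulSquare α β x x') (hy : KoszulSquare α β y y') :
    KoszulSquare α β (x - y) (x' - y') := by
  rw [sub_eq_add_neg, sub_eq_add_neg]
  exact hx.add hy.neg

lemma comp {z : Hom B E k} {z' : Hom B' E' k} (hz : KoszulSquare β γ z z')
    (hx : KoszulSquare α β x x') (e : k + m = p) :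
    KoszulSquare α γ (DGCategory.comp z x e) (DGCategory.comp z' x' e) := by
  intro r h h'
  rw [← assoc γ z x (p := n + k) rfl e (by lia) h, hz _ rfl (by lia), sign_comp,
    assoc z' β x (by lia) (q := n + m) rfl (by lia) (by lia), hx _ rfl (by lia), comp_sign,
    ← assoc z' x' α e (by lia) h' (by lia), smul_smul, ← Int.negOnePow_add, ← mul_add, e]

/-- Squares are closed under differentials of the horizontal sides as soon as the differentials of
the vertical sides also form a square. -/
lemma D {l r : ℤ} (hx : KoszulSquare α β x x') (hn : l + 1 = n)
    (hDx : KoszulSquare (DGCategory.D hn α) (DGCategory.D hn β) x x') (hm : r + 1 = m) :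
    KoszulSquare α β (DGCategory.D hm x) (DGCategory.D hm x') := by
  intro p h h'
  have e := congrArg (DGCategory.D (m := p) (n := p + 1) rfl)
    (hx (p + 1) (by lia) (by lia))
  rw [D_sign, D_comp _ _ _ hn hm _ (by lia) h, D_comp _ _ _ hm hn _ h' (by lia),
    hDx p (by lia) (by lia), smul_add, add_comm, smul_smul, ← Int.negOnePow_add] at e
  have s : (n * m + m).negOnePow = (l * m).negOnePow :=
    (Int.negOnePow_eq_iff _ _).2 ⟨m, by rw [← hn]; ring⟩
  rw [s, add_right_cancel_iff] at e
  have e' := congrArg (fun z => n.negOnePow • z) e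
  simp only [smul_smul, ← Int.negOnePow_add] at e'
  rw [Int.negOnePow_even (n + n) ⟨n, rfl⟩, one_smul] at e'
  rw [e']
  congr 1
  exact (Int.negOnePow_eq_iff _ _).2 ⟨n, by rw [← hm]; ring⟩

lemma transfer {δ : Hom A A (-1)} {δ' : Hom A' A' (-1)} {ε : Hom B B (-1)} {ε' : Hom B' B' (-1)}
    (P : Perturbation A δ) (P' : Perturbation A' δ') (Q : Perturbation B ε)
    (Q' : Perturbation B' ε') (hx : KoszulSquare α β x x') :
    KoszulSquare (P.transfer P' α) (Q.transfer Q' β) (P.transfer Q x) (P'.transfer Q' x') := by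
  intro p h h'
  rw [← Perturbation.transfer_comp, ← Perturbation.transfer_comp, hx p h h']
  simp only [Perturbation.transfer, sign_comp, comp_sign]

/-- The transfer of a vertical side commutes with differentials: the two terms that the perturbed
differentials add cancel. -/
lemma D_transfer {l : ℤ} {δ : Hom A A (-1)} {δ' : Hom A' A' (-1)}
    (hδ : KoszulSquare α α δ δ') (P : Perturbation A δ) (P' : Perturbation A' δ')
    (hn : l + 1 = n) :
    DGCategory.D hn (P.transfer P' α) = P.transfer P' (DGCategory.D hn α) := by
  rw [P.D_transfer P' hn (by lia) (by lia), hδ l (by lia) (by lia), smul_smul,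
    ← Int.negOnePow_add, mul_neg_one, add_neg_cancel, Int.negOnePow_zero, one_smul,
    add_sub_cancel_right]

end KoszulSquare

/-- A family of maps between two diagrams of shape `S` is dg-natural if it forms squares with the
generators `f`, `g`, `h` and so does its differential. The second condition enters because
expressions in the generators may contain differentials. -/
lemma koszulSquare_of_gen {C : Type u} [DGCategory.{v} C] {F G : DGFunctor SDR C} {n l : ℤ}
    (hn : l + 1 = n) (χ : ∀ a, Hom (F.obj a) (G.obj a) n)
    (h : ∀ {a b : SDR} {m : ℤ} (x : SDRGen a b m),
      KoszulSquare (χ a) (χ b) (F.map (PresHom.mk SDRGen SDRRel (.of x)))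
        (G.map (PresHom.mk SDRGen SDRRel (.of x))))
    (hD : ∀ {a b : SDR} {m : ℤ} (x : SDRGen a b m),
      KoszulSquare (D hn (χ a)) (D hn (χ b)) (F.map (PresHom.mk SDRGen SDRRel (.of x)))
        (G.map (PresHom.mk SDRGen SDRRel (.of x))))
    {a b : SDR} {m : ℤ} (y : Hom a b m) : KoszulSquare (χ a) (χ b) (F.map y) (G.map y) := by
  obtain ⟨x, rfl⟩ : ∃ x, y = PresHom.mk SDRGen SDRRel x := (Quot.exists_rep y).imp fun _ => Eq.symm
  suffices
      KoszulSquare (χ a) (χ b) (F.map (PresHom.mk SDRGen SDRRel x))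
        (G.map (PresHom.mk SDRGen SDRRel x)) ∧
      KoszulSquare (D hn (χ a)) (D hn (χ b)) (F.map (PresHom.mk SDRGen SDRRel x))
        (G.map (PresHom.mk SDRGen SDRRel x)) from this.1
  induction x with
  | of x => exact ⟨h x, hD x⟩
  | id a =>
    have e : ∀ H : DGFunctor SDR C,
        H.map (PresHom.mk SDRGen SDRRel (.id a)) = DGCategory.id (H.obj a) :=
      fun H => H.isDGFunctor.map_id a
    rw [e F, e G]
    exact ⟨.id, .id⟩
  | comp y x e ihy ihx =>
    have e' : ∀ H : DGFunctor SDR C, H.map (PresHom.mk SDRGen SDRRel (.comp y x e)) =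
        comp (H.map (PresHom.mk SDRGen SDRRel y)) (H.map (PresHom.mk SDRGen SDRRel x)) e :=
      fun H => H.isDGFunctor.map_comp (PresHom.mk SDRGen SDRRel y) (PresHom.mk SDRGen SDRRel x) e
    rw [e' F, e' G]
    exact ⟨ihy.1.comp ihx.1 e, ihy.2.comp ihx.2 e⟩
  | D e x ih =>
    have e' : ∀ H : DGFunctor SDR C, H.map (PresHom.mk SDRGen SDRRel (.D e x)) =
        D e (H.map (PresHom.mk SDRGen SDRRel x)) :=
      fun H => H.isDGFunctor.map_D e (PresHom.mk SDRGen SDRRel x)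
    rw [e' F, e' G]
    -- The second differential of `χ` vanishes, so the pair `χ`, `D χ` is closed under `D`.
    refine ⟨ih.1.D hn ih.2 e, ih.2.D (l := l - 1) (by lia) ?_ e⟩
    rw [D_D, D_D]
    exact .zero_sides _ _
  | zero =>
    have e : ∀ (H : DGFunctor SDR C) {a b : SDR} {m : ℤ},
        H.map (PresHom.mk SDRGen SDRRel (.zero : PreHom SDRGen a b m)) = 0 :=
      fun H => H.map_zero
    rw [e F, e G]
    exact ⟨.zero, .zero⟩
  | add x y ihx ihy =>
    have e : ∀ H : DGFunctor SDR C, H.map (PresHom.mk SDRGen SDRRel (.add x y)) =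
        H.map (PresHom.mk SDRGen SDRRel x) + H.map (PresHom.mk SDRGen SDRRel y) :=
      fun H => H.isDGFunctor.map_add (PresHom.mk SDRGen SDRRel x) (PresHom.mk SDRGen SDRRel y)
    rw [e F, e G]
    exact ⟨ihx.1.add ihy.1, ihx.2.add ihy.2⟩
  | neg x ih =>
    have e : ∀ H : DGFunctor SDR C, H.map (PresHom.mk SDRGen SDRRel (.neg x)) =
        -H.map (PresHom.mk SDRGen SDRRel x) :=
      fun H => H.map_neg (PresHom.mk SDRGen SDRRel x)
    rw [e F, e G]
    exact ⟨ih.1.neg, ih.2.neg⟩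

/-! ### The perturbation lemma on transformations -/

section Perturb

variable {C : Type u} [DGCategory.{v} C]

section Hat

variable {A A' B B' : C} {n : ℤ} {α : Hom A A' n} {β : Hom B B' n}
  {f : Hom A B 0} {f' : Hom A' B' 0} {g : Hom B A 0} {g' : Hom B' A' 0} {h : Hom A A 1}
  {h' : Hom A' A' 1} {δ : Hom A A (-1)} {δ' : Hom A' A' (-1)} {ι : Hom A A 0} {ι' : Hom A' A' 0}

lemma KoszulSquare.hatF (hf : KoszulSquare α β f f') (hι : KoszulSquare α α ι ι') :
    KoszulSquare α β (hatF f ι) (hatF f' ι') :=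
  hf.comp hι _

lemma KoszulSquare.hatG (hg : KoszulSquare β α g g') (hh : KoszulSquare α α h h')
    (hδ : KoszulSquare α α δ δ') (hι : KoszulSquare α α ι ι') :
    KoszulSquare β α (hatG g h δ ι) (hatG g' h' δ' ι') :=
  (KoszulSquare.id.sub (hh.comp (hι.comp hδ _) _)).comp hg _

lemma KoszulSquare.hatH (hh : KoszulSquare α α h h') (hι : KoszulSquare α α ι ι') :
    KoszulSquare α α (hatH h ι) (hatH h' ι') :=
  hh.comp hι _

lemma KoszulSquare.hatδ (hf : KoszulSquare α β f f') (hg : KoszulSquare β α g g')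
    (hδ : KoszulSquare α α δ δ') (hι : KoszulSquare α α ι ι') :
    KoszulSquare β β (hatδ f g δ ι) (hatδ f' g' δ' ι') :=
  (hf.hatF hι).comp (hδ.comp hg _) _

end Hat

variable (P : ChosenPerturbations C) {X Y : DGFunctor SDRPert C} {n : ℤ}

lemma koszulSquare_val (φ : Hom X Y n) {a b : SDRPert} {m : ℤ} (x : PreHom SDRPertGen a b m) :
    KoszulSquare (DGFunctor.app φ a) (DGFunctor.app φ b) (SDRPert.val X x) (SDRPert.val Y x) :=
  fun _ h h' => DGFunctor.natTrans_naturality φ (SDRPert.mk x) h h'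

lemma koszulSquare_targetδ (φ : Hom X Y n) :
    KoszulSquare (DGFunctor.app φ .t) (DGFunctor.app φ .t) (SDRPert.targetδ X)
      (SDRPert.targetδ Y) :=
  (koszulSquare_val φ SDRPert.f).hatδ (koszulSquare_val φ SDRPert.g)
    (koszulSquare_val φ SDRPert.δ) (koszulSquare_val φ SDRPert.ι)

/-- The components of a transformation, transferred to the perturbed objects. -/
noncomputable def perturbApp (φ : Hom X Y n) :
    ∀ a, Hom ((perturb P X).obj a) ((perturb P Y).obj a) n
  | .s => (SDRPert.source X P).transfer (SDRPert.source Y P) (DGFunctor.app φ .s)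
  | .t => (SDRPert.target X P).transfer (SDRPert.target Y P) (DGFunctor.app φ .t)

lemma D_perturbApp {l : ℤ} (hn : l + 1 = n) (φ : Hom X Y n) (a : SDR) :
    D hn (perturbApp P φ a) = perturbApp P (D hn φ) a := by
  cases a
  · exact (koszulSquare_val φ SDRPert.δ).D_transfer _ _ hn
  · exact (koszulSquare_targetδ φ).D_transfer _ _ hn

/-- The transferred components are compatible with the maps `f̂`, `ĝ`, `ĥ`. -/
lemma koszulSquare_perturbApp_gen (φ : Hom X Y n) {a b : SDR} {m : ℤ} (x : SDRGen a b m) :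
    KoszulSquare (perturbApp P φ a) (perturbApp P φ b)
      ((perturb P X).map (PresHom.mk SDRGen SDRRel (.of x)))
      ((perturb P Y).map (PresHom.mk SDRGen SDRRel (.of x))) := by
  have hf := koszulSquare_val φ SDRPert.f
  have hg := koszulSquare_val φ SDRPert.g
  have hh := koszulSquare_val φ SDRPert.h
  have hδ := koszulSquare_val φ SDRPert.δ
  have hι := koszulSquare_val φ SDRPert.ι
  cases x with
  | f => exact (hf.hatF hι).transfer _ _ _ _
  | g => exact (hg.hatG hh hδ hι).transfer _ _ _ _
  | h => exact (hh.hatH hι).transfer _ _ _ _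

/-- The effect of the perturbation lemma on dg-natural transformations. -/
noncomputable def perturbMap (φ : Hom X Y n) : Hom (perturb P X) (perturb P Y) n :=
  show DGFunctor.natTrans (perturb P X) (perturb P Y) n from
  ⟨perturbApp P φ, fun {_ _ _ _} x h h' =>
    koszulSquare_of_gen (l := n - 1) (by lia) (perturbApp P φ) (koszulSquare_perturbApp_gen P φ)
      (fun x => by
        rw [D_perturbApp, D_perturbApp]
        exact koszulSquare_perturbApp_gen P _ x) x _ h h'⟩

lemma isPerturbed_perturbMap (φ : Hom X Y n) : IsPerturbed P φ (perturbMap P φ) :=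
  ⟨rfl, rfl⟩

lemma isDGFunctor_perturbMap : IsDGFunctor (perturb P) (perturbMap P) where
  map_add x y := Subtype.ext <| funext fun a => by
    cases a
    · exact Perturbation.transfer_add _ _ _ _
    · exact Perturbation.transfer_add _ _ _ _
  map_id X := Subtype.ext <| funext fun a => by
    cases a
    · exact Perturbation.transfer_id _
    · exact Perturbation.transfer_id _
  map_comp y x h := Subtype.ext <| funext fun a => by
    cases a
    · exact Perturbation.transfer_comp _ _ _ _ _ h
    · exact Perturbation.transfer_comp _ _ _ _ _ h
  map_D h x := Subtype.ext <| funext fun a => (D_perturbApp P h x a).symm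

end Perturb

/-! ### Limit cones and isomorphisms -/

section Limits

variable {J : Type u₁} [DGCategory.{v₁} J] {C : Type u₂} [DGCategory.{v₂} C]

namespace WeightedCone

variable {W : LimitWeight.{v₁, u₁, w} J} {F : DGFunctor J C}

lemma isWeightHom_comp (c : WeightedCone W F) {X : C} {n : ℤ} (x : Hom X c.pt n) :
    IsWeightHom W F X n
      fun _ k w => (n * k).negOnePow • comp (c.leg w) x (add_comm k n) where
  map_add j k w w' := by rw [c.leg_add, add_comp, smul_add]
  map_act {i j m k p} y w h h' := by
    rw [c.leg_act, comp_sign, smul_smul, ← Int.negOnePow_add, ← mul_add, h,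
      assoc (F.map y) (c.leg w) x h (add_comm k n) (add_comm p n) h']

lemma IsLimit.hom_ext {c : WeightedCone W F} (hc : c.IsLimit) {X : C} {n : ℤ}
    {x y : Hom X c.pt n}
    (h : ∀ {j : J} {k : ℤ} (w : W.obj j k),
      comp (c.leg w) x (add_comm k n) = comp (c.leg w) y (add_comm k n)) : x = y :=
  (hc X n _ (c.isWeightHom_comp y)).unique (fun _ _ w => by rw [h w]) fun _ _ _ => rfl

/-- A cone isomorphic to a limit cone is a limit cone. The isomorphism of diagrams consists of `a`
and `a'`, that of apices of `b` and `b'`; no compatibility with differentials is needed, since being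
a limit cone does not refer to them. -/
lemma IsLimit.of_iso {c : WeightedCone W F} (hc : c.IsLimit) {F' : DGFunctor J C}
    (c' : WeightedCone W F') (a : ∀ j, Hom (F'.obj j) (F.obj j) 0)
    (a' : ∀ j, Hom (F.obj j) (F'.obj j) 0) (b : Hom c'.pt c.pt 0) (b' : Hom c.pt c'.pt 0)
    (ha : ∀ j, comp (p := 0) (a' j) (a j) rfl = DGCategory.id _)
    (hb : comp (p := 0) b b' rfl = DGCategory.id _)
    (hb' : comp (p := 0) b' b rfl = DGCategory.id _)
    (hF : ∀ {i j : J} {m : ℤ} (x : Hom i j m),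
      comp (a j) (F'.map x) (zero_add m) = comp (F.map x) (a i) (add_zero m))
    (hleg : ∀ {j : J} {k : ℤ} (w : W.obj j k),
      comp (a j) (c'.leg w) (zero_add k) = comp (c.leg w) b (add_zero k)) :
    c'.IsLimit := by
  intro X n φ hφ
  have hψ : IsWeightHom W F X n fun j k w => comp (a j) (φ j k w) (zero_add _) :=
    { map_add := fun j k w w' => by rw [hφ.map_add, comp_add]
      map_act := fun {i j m k p} x w h h' => by
        rw [hφ.map_act x w h h', comp_sign,
          ← assoc (a j) (F'.map x) (φ i k w) (zero_add m) h' h' (zero_add _), hF,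
          assoc (F.map x) (a i) (φ i k w) (add_zero m) (zero_add _) h' h'] }
  obtain ⟨x, hx, hx'⟩ := hc X n _ hψ
  refine ⟨comp b' x (zero_add n), fun j k w => ?_, fun y hy => ?_⟩
  · have e : comp (a' j) (comp (a j) (φ j k w) (zero_add _)) (zero_add _) = φ j k w := by
      rw [← assoc (a' j) (a j) (φ j k w) (p := 0) rfl (zero_add _) (zero_add _) (zero_add _), ha,
        DGCategory.id_comp]
    have e' : comp (a' j) (comp (c.leg w) x (add_comm k n)) (zero_add _) =
        comp (c'.leg w) (comp b' x (zero_add n)) (add_comm k n) := by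
      have hw : c'.leg w = comp (a' j) (comp (c.leg w) b (add_zero k)) (zero_add k) := by
        rw [← hleg, ← assoc (a' j) (a j) _ (p := 0) rfl (zero_add _) (zero_add _) (zero_add _),
          ha, DGCategory.id_comp]
      rw [hw, assoc (a' j) _ _ (zero_add k) (add_comm k n) (add_comm k n) (zero_add _),
        assoc (c.leg w) b _ (add_zero k) (zero_add n) (add_comm k n) (add_comm k n),
        ← assoc b b' x (p := 0) rfl (zero_add _) (zero_add _) (zero_add _), hb,
        DGCategory.id_comp]
    rw [← e, hx j k w, comp_sign, e']
  · rw [← hx' (comp b y (zero_add n)) fun j k w => ?_,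
      ← assoc b' b y (p := 0) rfl (zero_add _) (zero_add _) (zero_add _), hb', DGCategory.id_comp]
    rw [hy j k w, comp_sign, ← assoc (a j) (c'.leg w) y (zero_add k) (add_comm k n)
      (add_comm k n) (zero_add _), hleg,
      assoc (c.leg w) b y (add_zero k) (zero_add n) (add_comm k n) (add_comm k n)]

/-- A limit cone is isomorphic to every other limit cone over the same diagram. -/
lemma IsLimit.exists_iso {c c' : WeightedCone W F} (hc : c.IsLimit) (hc' : c'.IsLimit) :
    ∃ (b : Hom c'.pt c.pt 0) (b' : Hom c.pt c'.pt 0),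
      comp (p := 0) b b' rfl = DGCategory.id _ ∧ comp (p := 0) b' b rfl = DGCategory.id _ ∧
      ∀ {j : J} {k : ℤ} (w : W.obj j k), c'.leg w = comp (c.leg w) b (add_zero k) := by
  have key : ∀ {c c' : WeightedCone W F}, c.IsLimit → ∃ b : Hom c'.pt c.pt 0,
      ∀ {j : J} {k : ℤ} (w : W.obj j k), c'.leg w = comp (c.leg w) b (add_zero k) := by
    intro c c' hc
    obtain ⟨b, hb, -⟩ := hc c'.pt 0 _ (c'.isWeightHom_comp (DGCategory.id c'.pt))
    refine ⟨b, fun {j k} w => ?_⟩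
    have e := hb j k w
    simp only [zero_mul, Int.negOnePow_zero, one_smul] at e
    -- Pass from degree `0 + k` to degree `k`, in which the legs live.
    have cast : ∀ {q : ℤ} (h : k + 0 = q), comp (c'.leg w) (DGCategory.id c'.pt) (add_comm k 0) =
        comp (c.leg w) b (add_comm k 0) → comp (c'.leg w) (DGCategory.id c'.pt) h =
        comp (c.leg w) b h := by
      intro q h e
      obtain rfl : q = 0 + k := by lia
      exact e
    rw [← cast (add_zero k) e, DGCategory.comp_id]
  have key' : ∀ {c c' : WeightedCone W F} (_ : c.IsLimit) (b : Hom c'.pt c.pt 0)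
      (b' : Hom c.pt c'.pt 0),
      (∀ {j : J} {k : ℤ} (w : W.obj j k), c'.leg w = comp (c.leg w) b (add_zero k)) →
      (∀ {j : J} {k : ℤ} (w : W.obj j k), c.leg w = comp (c'.leg w) b' (add_zero k)) →
      comp (p := 0) b b' rfl = DGCategory.id _ := by
    intro c c' hc b b' hb hb'
    refine hc.hom_ext fun {j k} w => ?_
    have e : ∀ {q : ℤ} (h : k + 0 = q), comp (c.leg w) (comp (p := 0) b b' rfl) h =
        comp (c.leg w) (DGCategory.id c.pt) h := by
      intro q h
      obtain rfl : k = q := by lia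
      rw [← assoc (c.leg w) b b' (add_zero k) rfl (add_zero k) (add_zero k), ← hb, ← hb',
        DGCategory.comp_id]
    exact e _
  obtain ⟨b, hb⟩ := key (c' := c') hc
  obtain ⟨b', hb'⟩ := key (c' := c) hc'
  exact ⟨b, b', key' hc b b' hb hb', key' hc' b' b hb' hb, hb⟩

end WeightedCone

/-! ### Limits computed pointwise -/

section Pointwise

variable {A : Type u₃} [DGCategory.{v₃} A] {W : LimitWeight.{v₁, u₁, w} J}
  {F : DGFunctor J (DGFunctor A C)}

lemma koszulSquare_app {X Y : DGFunctor A C} {n m : ℤ} (φ : Hom X Y n) {a b : A} (y : Hom a b m) :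
    KoszulSquare (DGFunctor.app φ a) (DGFunctor.app φ b) (X.map y) (Y.map y) :=
  fun _ h h' => DGFunctor.natTrans_naturality φ y h h'

lemma app_sign {X Y : DGFunctor A C} {n : ℤ} (k : ℤ) (φ : Hom X Y n) (a : A) :
    DGFunctor.app (k.negOnePow • φ) a = k.negOnePow • DGFunctor.app φ a :=
  DGFunctor.natTrans_sign k φ a

/-- The leg of a cone over the values at `a` of a diagram of dg-functors, with codomain written as
`(F.obj j).obj a`, so that it composes with the components of transformations. -/
def WeightedCone.legAt {a : A} (l : WeightedCone W ((DGFunctor.eval a).comp F)) {j : J} {k : ℤ}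
    (w : W.obj j k) : Hom l.pt ((F.obj j).obj a) k :=
  l.leg w

lemma WeightedCone.legAt_add {a : A} (l : WeightedCone W ((DGFunctor.eval a).comp F)) {j : J}
    {n : ℤ} (w w' : W.obj j n) : l.legAt (w + w') = l.legAt w + l.legAt w' :=
  l.leg_add w w'

lemma WeightedCone.legAt_act {a : A} (l : WeightedCone W ((DGFunctor.eval a).comp F)) {i j : J}
    {n m p : ℤ} (x : Hom i j n) (w : W.obj i m) (h : n + m = p) :
    l.legAt (W.act x w h) = comp (DGFunctor.app (F.map x) a) (l.legAt w) h :=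
  l.leg_act x w h

lemma WeightedCone.D_legAt {a : A} (l : WeightedCone W ((DGFunctor.eval a).comp F)) {j : J}
    {n m : ℤ} (w : W.obj j n) (h : m + 1 = n) :
    D h (l.legAt w) = l.legAt (W.d h w) :=
  (l.leg_d h w).symm

/-- Limits of dg-functors which are computed pointwise are limits. -/
lemma WeightedCone.isLimit_of_eval (c : WeightedCone W F)
    (hc : ∀ a, ((DGFunctor.eval a).mapCone c).IsLimit) : c.IsLimit := by
  intro X n φ hφ
  have hψ : ∀ a, IsWeightHom W ((DGFunctor.eval a).comp F) (X.obj a) n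
      fun j k w => DGFunctor.app (φ j k w) a := fun a =>
    { map_add := fun j k w w' => by rw [hφ.map_add]; rfl
      map_act := fun {i j m k p} x w h h' => by rw [hφ.map_act x w h h', app_sign]; rfl }
  have key : ∀ a, ∃ x : Hom (X.obj a) (c.pt.obj a) n,
      (∀ (j : J) (k : ℤ) (w : W.obj j k), DGFunctor.app (φ j k w) a =
        (n * k).negOnePow • comp (DGFunctor.app (c.leg w) a) x (add_comm k n)) ∧
      ∀ y : Hom (X.obj a) (c.pt.obj a) n,
        (∀ (j : J) (k : ℤ) (w : W.obj j k), DGFunctor.app (φ j k w) a =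
          (n * k).negOnePow • comp (DGFunctor.app (c.leg w) a) y (add_comm k n)) → y = x :=
    fun a => hc a _ n _ (hψ a)
  choose x hx₁ hx' using key
  have hx₂ : ∀ (a : A) (j : J) (k : ℤ) (w : W.obj j k),
      comp (DGFunctor.app (c.leg w) a) (x a) (add_comm k n) =
      (n * k).negOnePow • DGFunctor.app (φ j k w) a := by
    intro a j k w
    rw [hx₁, smul_smul, ← Int.negOnePow_add, Int.negOnePow_even _ ⟨_, rfl⟩, one_smul]
  -- The maps `x a` form a transformation, as can be checked after composition with the legs.
  have nat : ∀ {a b : A} {m : ℤ} (y : Hom a b m),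
      KoszulSquare (x a) (x b) (X.map y) (c.pt.map y) := by
    intro a b m y p h h'
    refine (hc b).hom_ext fun {j k} w => ?_
    change comp (DGFunctor.app (c.leg w) b) (comp (x b) (X.map y) h) (add_comm k p) =
      comp (DGFunctor.app (c.leg w) b) ((n * m).negOnePow • comp (c.pt.map y) (x a) h')
        (add_comm k p)
    rw [comp_sign, ← assoc _ (x b) (X.map y) (add_comm k n) h (by lia) (add_comm k p), hx₂,
      sign_comp, koszulSquare_app (φ j k w) y _ (by lia) (by lia),
      ← assoc _ (c.pt.map y) (x a) (p := k + m) rfl h' (by lia) (add_comm k p),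
      koszulSquare_app (c.leg w) y _ rfl (by lia), sign_comp,
      assoc ((F.obj j).map y) _ (x a) (by lia) (add_comm k n) (by lia) (by lia), hx₂, comp_sign]
    simp only [smul_smul, ← Int.negOnePow_add]
    congr 1
    exact (Int.negOnePow_eq_iff _ _).2 ⟨0, by ring⟩
  obtain ⟨z, hz⟩ : ∃ z : Hom X c.pt n, ∀ a, DGFunctor.app z a = x a :=
    ⟨⟨x, fun {_ _ _ _} y h h' => nat y _ h h'⟩, fun _ => rfl⟩
  refine ⟨z, fun j k w => Subtype.ext (funext fun a => ?_),
    fun y hy => Subtype.ext (funext fun a => ?_)⟩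
  · have e := hx₁ a j k w
    rw [← hz] at e
    exact e.trans (app_sign (n * k) (comp (c.leg w) z (add_comm k n)) a).symm
  · refine (hx' a (DGFunctor.app y a) fun j k w => ?_).trans (hz a).symm
    exact (congrArg (fun z => DGFunctor.app z a) (hy j k w)).trans
      (app_sign (n * k) (comp (c.leg w) y (add_comm k n)) a)

/-- The action of a morphism `y : a → b` on pointwise limits. It is induced by the element
`w ↦ F j y ∘ leg w` of degree `|y|` of the complex of transformations from the weight. -/
lemma WeightedCone.IsLimit.existsUnique_koszulSquare {a b : A}
    (la : WeightedCone W ((DGFunctor.eval a).comp F))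
    {lb : WeightedCone W ((DGFunctor.eval b).comp F)} (hb : lb.IsLimit) {m : ℤ} (y : Hom a b m) :
    ∃! x : Hom la.pt lb.pt m, ∀ {j : J} {k : ℤ} (w : W.obj j k),
      KoszulSquare (la.legAt w) (lb.legAt w) x ((F.obj j).map y) := by
  have h_add : ∀ (j : J) (k : ℤ) (w w' : W.obj j k),
      comp ((F.obj j).map y) (la.legAt (w + w')) rfl =
        comp ((F.obj j).map y) (la.legAt w) rfl + comp ((F.obj j).map y) (la.legAt w') rfl := by
    intro j k w w'
    rw [la.legAt_add, comp_add]
  have h_act : ∀ {i j : J} {d k p : ℤ} (x : Hom i j d) (w : W.obj i k) (h : d + k = p)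
      (h' : d + (m + k) = m + p), comp ((F.obj j).map y) (la.legAt (W.act x w h)) rfl =
        (m * d).negOnePow •
          comp (DGFunctor.app (F.map x) b) (comp ((F.obj i).map y) (la.legAt w) rfl) h' := by
    intro i j d k p x w h h'
    rw [la.legAt_act, ← assoc ((F.obj j).map y) (DGFunctor.app (F.map x) a) (la.legAt w)
        (p := m + d) rfl h (by lia) rfl,
      ← assoc (DGFunctor.app (F.map x) b) ((F.obj i).map y) (la.legAt w)
        (p := m + d) (by lia) rfl (by lia) h',
      koszulSquare_app (F.map x) y _ (by lia) rfl, sign_comp, smul_smul,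
      ← Int.negOnePow_add, Int.negOnePow_even _ ⟨m * d, by ring⟩, one_smul]
  have hφ : IsWeightHom W ((DGFunctor.eval b).comp F) la.pt m
      fun j k w => comp ((F.obj j).map y) (la.legAt w) rfl := ⟨h_add, h_act⟩
  obtain ⟨x, hx, hx'⟩ := hb _ m _ hφ
  refine ⟨x, fun {j k} w p h h' => ?_, fun z hz => hx' z fun j k w => ?_⟩
  · obtain rfl : p = m + k := by lia
    have e : comp ((F.obj j).map y) (la.legAt w) rfl =
      (m * k).negOnePow • comp (lb.legAt w) x (add_comm k m) := hx j k w
    rw [e, smul_smul, ← Int.negOnePow_add, Int.negOnePow_even _ ⟨m * k, by ring⟩, one_smul]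
  · change comp ((F.obj j).map y) (la.legAt w) rfl =
      (m * k).negOnePow • comp (lb.legAt w) z (add_comm k m)
    rw [hz w _ (add_comm k m) rfl, smul_smul, ← Int.negOnePow_add,
      Int.negOnePow_even _ ⟨m * k, by ring⟩, one_smul]

section

variable (l : ∀ a, WeightedCone W ((DGFunctor.eval a).comp F)) (hl : ∀ a, (l a).IsLimit)

/-- The morphism induced by `y : a → b` on chosen pointwise limits. -/
noncomputable def pointwiseLimitMap {a b : A} {m : ℤ} (y : Hom a b m) :
    Hom (l a).pt (l b).pt m :=
  ((hl b).existsUnique_koszulSquare (l a) y).choose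

lemma pointwiseLimitMap_spec {a b : A} {m : ℤ} (y : Hom a b m) {j : J} {k : ℤ} (w : W.obj j k) :
    KoszulSquare ((l a).legAt w) ((l b).legAt w) (pointwiseLimitMap l hl y) ((F.obj j).map y) :=
  ((hl b).existsUnique_koszulSquare (l a) y).choose_spec.1 w

lemma pointwiseLimitMap_eq {a b : A} {m : ℤ} {y : Hom a b m} {x : Hom (l a).pt (l b).pt m}
    (hx : ∀ {j : J} {k : ℤ} (w : W.obj j k),
      KoszulSquare ((l a).legAt w) ((l b).legAt w) x ((F.obj j).map y)) :
    pointwiseLimitMap l hl y = x :=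
  (((hl b).existsUnique_koszulSquare (l a) y).choose_spec.2 x hx).symm

/-- The dg-functor `a ↦ {W, F(-)(a)}` of chosen pointwise limits. -/
noncomputable def pointwiseLimit : DGFunctor A C where
  obj a := (l a).pt
  map y := pointwiseLimitMap l hl y
  isDGFunctor :=
    { map_add := fun x y => pointwiseLimitMap_eq l hl fun {j _} w => by
        rw [(F.obj j).isDGFunctor.map_add]
        exact (pointwiseLimitMap_spec l hl x w).add (pointwiseLimitMap_spec l hl y w)
      map_id := fun a => pointwiseLimitMap_eq l hl fun {j _} w => by
        rw [(F.obj j).isDGFunctor.map_id]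
        exact .id
      map_comp := fun y x h => pointwiseLimitMap_eq l hl fun {j _} w => by
        rw [(F.obj j).isDGFunctor.map_comp]
        exact (pointwiseLimitMap_spec l hl y w).comp (pointwiseLimitMap_spec l hl x w) h
      map_D := fun {a b _ _} h x => pointwiseLimitMap_eq l hl fun {j k} w => by
        rw [(F.obj j).isDGFunctor.map_D]
        -- The differential of the leg at `w` is the leg at `d w`, which forms squares as well.
        refine (pointwiseLimitMap_spec l hl x w).D (l := k - 1) (by lia) ?_ h
        rw [(l a).D_legAt, (l b).D_legAt]
        exact pointwiseLimitMap_spec l hl x _ }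

/-- The cone over `F` with the pointwise limit as apex. -/
noncomputable def pointwiseLimitCone : WeightedCone W F where
  pt := pointwiseLimit l hl
  leg {j k} w := show DGFunctor.natTrans (pointwiseLimit l hl) (F.obj j) k from
    ⟨fun a => (l a).leg w, fun y h h' => pointwiseLimitMap_spec l hl y w _ h h'⟩
  leg_add w w' := Subtype.ext (funext fun a => (l a).leg_add w w')
  leg_d h w := Subtype.ext (funext fun a => (l a).leg_d h w)
  leg_act x w h := Subtype.ext (funext fun a => (l a).leg_act x w h)

end

/-- If the pointwise limits exist, then limits of dg-functors are computed pointwise: the limit is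
isomorphic to the one constructed from the pointwise limits. -/
lemma WeightedCone.IsLimit.eval {c : WeightedCone W F} (hc : c.IsLimit)
    (h : ∀ a, HasWeightedLimit W ((DGFunctor.eval a).comp F)) (a : A) :
    ((DGFunctor.eval a).mapCone c).IsLimit := by
  choose l hl using h
  obtain ⟨b, b', hb, hb', hleg⟩ :=
    ((pointwiseLimitCone l hl).isLimit_of_eval hl).exists_iso hc
  refine (hl a).of_iso _ (fun j => DGCategory.id _) (fun j => DGCategory.id _)
    (DGFunctor.app b a) (DGFunctor.app b' a) (fun j => DGCategory.id_comp _ _)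
    (congrArg (fun z => DGFunctor.app z a) hb) (congrArg (fun z => DGFunctor.app z a) hb')
    (fun x => (DGCategory.id_comp _ _).trans (DGCategory.comp_id _ _).symm) fun w =>
    (DGCategory.id_comp _ _).trans (congrArg (fun z => DGFunctor.app z a) (hleg w))

end Pointwise

end Limits

/-! ### Colimit cocones and isomorphisms -/

section Colimits

variable {J : Type u₁} [DGCategory.{v₁} J] {C : Type u₂} [DGCategory.{v₂} C]

namespace WeightedCocone

variable {W : ColimitWeight.{v₁, u₁, w} J} {F : DGFunctor J C}

lemma isCoweightHom_comp (c : WeightedCocone W F) {X : C} {n : ℤ} (x : Hom c.pt X n) :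
    IsCoweightHom W F X n fun _ _ w => comp x (c.leg w) rfl where
  map_add j k w w' := by rw [c.leg_add, comp_add]
  map_act {i j k m p} w y h h' := by
    rw [c.leg_act, assoc x (c.leg w) (F.map y) rfl h h' rfl]

lemma IsColimit.hom_ext {c : WeightedCocone W F} (hc : c.IsColimit) {X : C} {n : ℤ}
    {x y : Hom c.pt X n}
    (h : ∀ {j : J} {k : ℤ} (w : W.obj j k),
      comp x (c.leg w) (rfl : n + k = n + k) = comp y (c.leg w) rfl) : x = y :=
  (hc X n _ (c.isCoweightHom_comp y)).unique (fun _ _ w => (h w).symm) fun _ _ _ => rfl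

/-- A cocone isomorphic to a colimit cocone is a colimit cocone. The isomorphism of diagrams
consists of `a` and `a'`, that of apices of `b` and `b'`; no compatibility with differentials is
needed, since being a colimit cocone does not refer to them. -/
lemma IsColimit.of_iso {c : WeightedCocone W F} (hc : c.IsColimit) {F' : DGFunctor J C}
    (c' : WeightedCocone W F') (a : ∀ j, Hom (F.obj j) (F'.obj j) 0)
    (a' : ∀ j, Hom (F'.obj j) (F.obj j) 0) (b : Hom c.pt c'.pt 0) (b' : Hom c'.pt c.pt 0)
    (ha : ∀ j, comp (p := 0) (a j) (a' j) rfl = DGCategory.id _)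
    (hb : comp (p := 0) b b' rfl = DGCategory.id _)
    (hb' : comp (p := 0) b' b rfl = DGCategory.id _)
    (hF : ∀ {i j : J} {m : ℤ} (x : Hom i j m),
      comp (F'.map x) (a i) (add_zero m) = comp (a j) (F.map x) (zero_add m))
    (hleg : ∀ {j : J} {k : ℤ} (w : W.obj j k),
      comp (c'.leg w) (a j) (add_zero k) = comp b (c.leg w) (zero_add k)) :
    c'.IsColimit := by
  intro X n φ hφ
  have hψ : IsCoweightHom W F X n fun j k w => comp (φ j k w) (a j) (add_zero _) :=
    { map_add := fun j k w w' => by rw [hφ.map_add, add_comp]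
      map_act := fun {i j k m p} w x h h' => by
        rw [hφ.map_act w x h h', assoc (φ j k w) (F'.map x) (a i) h' (add_zero m) (add_zero _) h',
          hF, ← assoc (φ j k w) (a j) (F.map x) (add_zero _) (zero_add m) h' h'] }
  obtain ⟨x, hx, hx'⟩ := hc X n _ hψ
  have hx₁ : ∀ (j : J) (k : ℤ) (w : W.obj j k),
      comp (φ j k w) (a j) (add_zero _) = comp x (c.leg w) rfl := hx
  refine ⟨comp x b' (add_zero n), fun j k w => ?_, fun y hy => ?_⟩
  · have e : comp (comp (φ j k w) (a j) (add_zero _)) (a' j) (add_zero _) = φ j k w := by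
      rw [assoc (φ j k w) (a j) (a' j) (q := 0) (add_zero _) rfl (add_zero _) (add_zero _), ha,
        DGCategory.comp_id]
    have hw : c'.leg w = comp (comp b (c.leg w) (zero_add k)) (a' j) (add_zero k) := by
      rw [← hleg, assoc _ (a j) (a' j) (q := 0) (add_zero _) rfl (add_zero _) (add_zero _),
        ha, DGCategory.comp_id]
    rw [← e, hx₁ j k w, hw, ← assoc _ _ (a' j) (p := n + k) rfl (add_zero k) (add_zero _) rfl,
      assoc x b' _ (add_zero n) (zero_add k) rfl rfl,
      ← assoc b' b (c.leg w) (p := 0) rfl (zero_add k) (zero_add k) (zero_add k), hb',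
      DGCategory.id_comp]
  · rw [← hx' (comp y b (add_zero n)) fun j k w => ?_,
      assoc y b b' (q := 0) (add_zero _) rfl (add_zero _) (add_zero _), hb, DGCategory.comp_id]
    rw [hy j k w, assoc y (c'.leg w) (a j) rfl (add_zero k) (add_zero _) rfl, hleg,
      ← assoc y b (c.leg w) (add_zero n) (zero_add k) rfl rfl]

/-- A colimit cocone is isomorphic to every other colimit cocone under the same diagram. -/
lemma IsColimit.exists_iso {c c' : WeightedCocone W F} (hc : c.IsColimit) (hc' : c'.IsColimit) :
    ∃ (b : Hom c.pt c'.pt 0) (b' : Hom c'.pt c.pt 0),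
      comp (p := 0) b b' rfl = DGCategory.id _ ∧ comp (p := 0) b' b rfl = DGCategory.id _ ∧
      ∀ {j : J} {k : ℤ} (w : W.obj j k), c'.leg w = comp b (c.leg w) (zero_add k) := by
  have key : ∀ {c c' : WeightedCocone W F}, c.IsColimit → ∃ b : Hom c.pt c'.pt 0,
      ∀ {j : J} {k : ℤ} (w : W.obj j k), c'.leg w = comp b (c.leg w) (zero_add k) := by
    intro c c' hc
    obtain ⟨b, hb, -⟩ := hc c'.pt 0 _ (c'.isCoweightHom_comp (DGCategory.id c'.pt))
    refine ⟨b, fun {j k} w => ?_⟩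
    -- Pass from degree `0 + k` to degree `k`, in which the legs live.
    have cast : ∀ {q : ℤ} (h : 0 + k = q), comp (DGCategory.id c'.pt) (c'.leg w) h =
        comp b (c.leg w) h := by
      intro q h
      obtain rfl : q = 0 + k := h.symm
      exact hb j k w
    rw [← cast (zero_add k), DGCategory.id_comp]
  have key' : ∀ {c c' : WeightedCocone W F} (_ : c.IsColimit) (b : Hom c.pt c'.pt 0)
      (b' : Hom c'.pt c.pt 0),
      (∀ {j : J} {k : ℤ} (w : W.obj j k), c'.leg w = comp b (c.leg w) (zero_add k)) →
      (∀ {j : J} {k : ℤ} (w : W.obj j k), c.leg w = comp b' (c'.leg w) (zero_add k)) →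
      comp (p := 0) b' b rfl = DGCategory.id _ := by
    intro c c' hc b b' hb hb'
    refine hc.hom_ext fun {j k} w => ?_
    have e : ∀ {q : ℤ} (h : 0 + k = q), comp (comp (p := 0) b' b rfl) (c.leg w) h =
        comp (DGCategory.id c.pt) (c.leg w) h := by
      intro q h
      obtain rfl : k = q := by lia
      rw [assoc b' b (c.leg w) rfl (zero_add k) (zero_add k) (zero_add k), ← hb, ← hb',
        DGCategory.id_comp]
    exact e _
  obtain ⟨b, hb⟩ := key (c' := c') hc
  obtain ⟨b', hb'⟩ := key (c' := c) hc'
  exact ⟨b, b', key' hc' b' b hb' hb, key' hc b b' hb hb', hb⟩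

end WeightedCocone

/-! ### Colimits computed pointwise -/

section Pointwise

variable {A : Type u₃} [DGCategory.{v₃} A] {W : ColimitWeight.{v₁, u₁, w} J}
  {F : DGFunctor J (DGFunctor A C)}

/-- The leg of a cocone under the values at `a` of a diagram of dg-functors, with domain written as
`(F.obj j).obj a`, so that it composes with the components of transformations. -/
def WeightedCocone.legAt {a : A} (l : WeightedCocone W ((DGFunctor.eval a).comp F)) {j : J} {k : ℤ}
    (w : W.obj j k) : Hom ((F.obj j).obj a) l.pt k :=
  l.leg w

lemma WeightedCocone.legAt_add {a : A} (l : WeightedCocone W ((DGFunctor.eval a).comp F)) {j : J}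
    {n : ℤ} (w w' : W.obj j n) : l.legAt (w + w') = l.legAt w + l.legAt w' :=
  l.leg_add w w'

lemma WeightedCocone.legAt_act {a : A} (l : WeightedCocone W ((DGFunctor.eval a).comp F)) {i j : J}
    {n m p : ℤ} (w : W.obj j n) (x : Hom i j m) (h : n + m = p) :
    l.legAt (W.act w x h) = comp (l.legAt w) (DGFunctor.app (F.map x) a) h :=
  l.leg_act w x h

lemma WeightedCocone.D_legAt {a : A} (l : WeightedCocone W ((DGFunctor.eval a).comp F)) {j : J}
    {n m : ℤ} (w : W.obj j n) (h : m + 1 = n) :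
    D h (l.legAt w) = l.legAt (W.d h w) :=
  (l.leg_d h w).symm

/-- Colimits of dg-functors which are computed pointwise are colimits. -/
lemma WeightedCocone.isColimit_of_eval (c : WeightedCocone W F)
    (hc : ∀ a, ((DGFunctor.eval a).mapCocone c).IsColimit) : c.IsColimit := by
  intro X n φ hφ
  have hψ : ∀ a, IsCoweightHom W ((DGFunctor.eval a).comp F) (X.obj a) n
      fun j k w => DGFunctor.app (φ j k w) a := fun a =>
    { map_add := fun j k w w' => by rw [hφ.map_add]; rfl
      map_act := fun {i j k m p} w x h h' => by rw [hφ.map_act w x h h']; rfl }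
  have key : ∀ a, ∃ x : Hom (c.pt.obj a) (X.obj a) n,
      (∀ (j : J) (k : ℤ) (w : W.obj j k), DGFunctor.app (φ j k w) a =
        comp x (DGFunctor.app (c.leg w) a) rfl) ∧
      ∀ y : Hom (c.pt.obj a) (X.obj a) n,
        (∀ (j : J) (k : ℤ) (w : W.obj j k), DGFunctor.app (φ j k w) a =
          comp y (DGFunctor.app (c.leg w) a) rfl) → y = x :=
    fun a => hc a _ n _ (hψ a)
  choose x hx hx' using key
  -- The maps `x a` form a transformation, as can be checked after composition with the legs.
  have nat : ∀ {a b : A} {m : ℤ} (y : Hom a b m),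
      KoszulSquare (x a) (x b) (c.pt.map y) (X.map y) := by
    intro a b m y p h h'
    refine (hc a).hom_ext fun {j k} w => ?_
    change comp (comp (x b) (c.pt.map y) h) (DGFunctor.app (c.leg w) a) rfl =
      comp ((n * m).negOnePow • comp (X.map y) (x a) h') (DGFunctor.app (c.leg w) a) rfl
    have e := koszulSquare_app (c.leg w) y (k + m) rfl (by lia)
    have e' : comp (c.pt.map y) (DGFunctor.app (c.leg w) a) (add_comm m k) =
        (k * m).negOnePow • comp (DGFunctor.app (c.leg w) b) ((F.obj j).map y) rfl := by
      rw [e, smul_smul, ← Int.negOnePow_add, Int.negOnePow_even _ ⟨k * m, rfl⟩, one_smul]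
    rw [sign_comp, assoc (x b) (c.pt.map y) _ h (add_comm m k) rfl (by lia), e', comp_sign,
      ← assoc (x b) _ ((F.obj j).map y) (p := n + k) rfl rfl (by lia) (by lia), ← hx,
      koszulSquare_app (φ j k w) y _ (by lia) (by lia),
      assoc (X.map y) (x a) _ h' (q := n + k) rfl rfl (by lia), ← hx, smul_smul,
      ← Int.negOnePow_add]
    congr 1
    exact (Int.negOnePow_eq_iff _ _).2 ⟨k * m, by ring⟩
  obtain ⟨z, hz⟩ : ∃ z : Hom c.pt X n, ∀ a, DGFunctor.app z a = x a :=
    ⟨⟨x, fun {_ _ _ _} y h h' => nat y _ h h'⟩, fun _ => rfl⟩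
  refine ⟨z, fun j k w => Subtype.ext (funext fun a => ?_),
    fun y hy => Subtype.ext (funext fun a => ?_)⟩
  · have e := hx a j k w
    rw [← hz] at e
    exact e
  · exact (hx' a (DGFunctor.app y a) fun j k w =>
      congrArg (fun z => DGFunctor.app z a) (hy j k w)).trans (hz a).symm

/-- The action of a morphism `y : a → b` on pointwise colimits. It is induced by the element
`w ↦ (-1)^(|w| |y|) leg w ∘ F j y` of degree `|y|` of the complex of transformations from the
weight. -/
lemma WeightedCocone.IsColimit.existsUnique_koszulSquare {a b : A}
    {la : WeightedCocone W ((DGFunctor.eval a).comp F)} (ha : la.IsColimit)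
    (lb : WeightedCocone W ((DGFunctor.eval b).comp F)) {m : ℤ} (y : Hom a b m) :
    ∃! x : Hom la.pt lb.pt m, ∀ {j : J} {k : ℤ} (w : W.obj j k),
      KoszulSquare (la.legAt w) (lb.legAt w) ((F.obj j).map y) x := by
  have h_add : ∀ (j : J) (k : ℤ) (w w' : W.obj j k),
      (k * m).negOnePow • comp (lb.legAt (w + w')) ((F.obj j).map y) (add_comm k m) =
        (k * m).negOnePow • comp (lb.legAt w) ((F.obj j).map y) (add_comm k m) +
          (k * m).negOnePow • comp (lb.legAt w') ((F.obj j).map y) (add_comm k m) := by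
    intro j k w w'
    rw [lb.legAt_add, add_comp, smul_add]
  have h_act : ∀ {i j : J} {k d p : ℤ} (w : W.obj j k) (x : Hom i j d) (h : k + d = p)
      (h' : (m + k) + d = m + p),
      (p * m).negOnePow • comp (lb.legAt (W.act w x h)) ((F.obj i).map y) (add_comm p m) =
        comp ((k * m).negOnePow • comp (lb.legAt w) ((F.obj j).map y) (add_comm k m))
          (DGFunctor.app (F.map x) a) h' := by
    intro i j k d p w x h h'
    rw [lb.legAt_act, assoc _ (DGFunctor.app (F.map x) b) ((F.obj i).map y) h (q := d + m) rfl
        (add_comm p m) (by lia), koszulSquare_app (F.map x) y _ rfl (by lia), comp_sign,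
      ← assoc (lb.legAt w) ((F.obj j).map y) (DGFunctor.app (F.map x) a) (add_comm k m)
        (by lia) h' (by lia), sign_comp, smul_smul, ← Int.negOnePow_add]
    congr 1
    exact (Int.negOnePow_eq_iff _ _).2 ⟨d * m, by rw [← h]; ring⟩
  have hφ : IsCoweightHom W ((DGFunctor.eval a).comp F) lb.pt m
      fun j k w => (k * m).negOnePow • comp (lb.legAt w) ((F.obj j).map y) (add_comm k m) :=
    ⟨h_add, h_act⟩
  obtain ⟨x, hx, hx'⟩ := ha _ m _ hφ
  refine ⟨x, fun {j k} w p h h' => ?_, fun z hz => hx' z fun j k w => ?_⟩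
  · obtain rfl : p = m + k := by lia
    have e : (k * m).negOnePow • comp (lb.legAt w) ((F.obj j).map y) (add_comm k m) =
      comp x (la.legAt w) rfl := hx j k w
    rw [← e, smul_smul, ← Int.negOnePow_add, Int.negOnePow_even _ ⟨k * m, rfl⟩, one_smul]
  · change (k * m).negOnePow • comp (lb.legAt w) ((F.obj j).map y) (add_comm k m) =
      comp z (la.legAt w) rfl
    rw [hz w _ (add_comm k m) rfl, smul_smul, ← Int.negOnePow_add,
      Int.negOnePow_even _ ⟨k * m, rfl⟩, one_smul]

section

variable (l : ∀ a, WeightedCocone W ((DGFunctor.eval a).comp F)) (hl : ∀ a, (l a).IsColimit)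

/-- The morphism induced by `y : a → b` on chosen pointwise colimits. -/
noncomputable def pointwiseColimitMap {a b : A} {m : ℤ} (y : Hom a b m) :
    Hom (l a).pt (l b).pt m :=
  ((hl a).existsUnique_koszulSquare (l b) y).choose

lemma pointwiseColimitMap_spec {a b : A} {m : ℤ} (y : Hom a b m) {j : J} {k : ℤ} (w : W.obj j k) :
    KoszulSquare ((l a).legAt w) ((l b).legAt w) ((F.obj j).map y) (pointwiseColimitMap l hl y) :=
  ((hl a).existsUnique_koszulSquare (l b) y).choose_spec.1 w

lemma pointwiseColimitMap_eq {a b : A} {m : ℤ} {y : Hom a b m} {x : Hom (l a).pt (l b).pt m}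
    (hx : ∀ {j : J} {k : ℤ} (w : W.obj j k),
      KoszulSquare ((l a).legAt w) ((l b).legAt w) ((F.obj j).map y) x) :
    pointwiseColimitMap l hl y = x :=
  (((hl a).existsUnique_koszulSquare (l b) y).choose_spec.2 x hx).symm

/-- The dg-functor `a ↦ W * F(-)(a)` of chosen pointwise colimits. -/
noncomputable def pointwiseColimit : DGFunctor A C where
  obj a := (l a).pt
  map y := pointwiseColimitMap l hl y
  isDGFunctor :=
    { map_add := fun x y => pointwiseColimitMap_eq l hl fun {j _} w => by
        rw [(F.obj j).isDGFunctor.map_add]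
        exact (pointwiseColimitMap_spec l hl x w).add (pointwiseColimitMap_spec l hl y w)
      map_id := fun a => pointwiseColimitMap_eq l hl fun {j _} w => by
        rw [(F.obj j).isDGFunctor.map_id]
        exact .id
      map_comp := fun y x h => pointwiseColimitMap_eq l hl fun {j _} w => by
        rw [(F.obj j).isDGFunctor.map_comp]
        exact (pointwiseColimitMap_spec l hl y w).comp (pointwiseColimitMap_spec l hl x w) h
      map_D := fun {a b _ _} h x => pointwiseColimitMap_eq l hl fun {j k} w => by
        rw [(F.obj j).isDGFunctor.map_D]
        -- The differential of the leg at `w` is the leg at `d w`, which forms squares as well.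
        refine (pointwiseColimitMap_spec l hl x w).D (l := k - 1) (by lia) ?_ h
        rw [(l a).D_legAt, (l b).D_legAt]
        exact pointwiseColimitMap_spec l hl x _ }

/-- The cocone under `F` with the pointwise colimit as apex. -/
noncomputable def pointwiseColimitCocone : WeightedCocone W F where
  pt := pointwiseColimit l hl
  leg {j k} w := show DGFunctor.natTrans (F.obj j) (pointwiseColimit l hl) k from
    ⟨fun a => (l a).leg w, fun y h h' => pointwiseColimitMap_spec l hl y w _ h h'⟩
  leg_add w w' := Subtype.ext (funext fun a => (l a).leg_add w w')
  leg_d h w := Subtype.ext (funext fun a => (l a).leg_d h w)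
  leg_act w x h := Subtype.ext (funext fun a => (l a).leg_act w x h)

end

/-- If the pointwise colimits exist, then colimits of dg-functors are computed pointwise: the
colimit is isomorphic to the one constructed from the pointwise colimits. -/
lemma WeightedCocone.IsColimit.eval {c : WeightedCocone W F} (hc : c.IsColimit)
    (h : ∀ a, HasWeightedColimit W ((DGFunctor.eval a).comp F)) (a : A) :
    ((DGFunctor.eval a).mapCocone c).IsColimit := by
  choose l hl using h
  obtain ⟨b, b', hb, hb', hleg⟩ :=
    ((pointwiseColimitCocone l hl).isColimit_of_eval hl).exists_iso hc
  refine (hl a).of_iso _ (fun j => DGCategory.id _) (fun j => DGCategory.id _)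
    (DGFunctor.app b a) (DGFunctor.app b' a) (fun j => DGCategory.id_comp _ _)
    (congrArg (fun z => DGFunctor.app z a) hb) (congrArg (fun z => DGFunctor.app z a) hb')
    (fun x => (DGCategory.comp_id _ _).trans (DGCategory.id_comp _ _).symm) fun w =>
    (DGCategory.comp_id _ _).trans (congrArg (fun z => DGFunctor.app z a) (hleg w))

end Pointwise

end Colimits

/-! ### Perturbation preserves limits and colimits -/

section Preservation

namespace Perturbation

variable {C : Type u} [DGCategory.{v} C] {A B : C} {δ : Hom A A (-1)} {ε : Hom B B (-1)}

lemma φ_transfer (P : Perturbation A δ) (Q : Perturbation B ε) {n : ℤ} (x : Hom A B n) :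
    comp Q.φ (P.transfer Q x) (zero_add n) = comp x P.φ (add_zero n) := by
  rw [transfer, ← assoc Q.φ Q.ψ _ (p := 0) rfl (zero_add n) (zero_add n) (zero_add n), φ_ψ,
    DGCategory.id_comp]

lemma transfer_ψ (P : Perturbation A δ) (Q : Perturbation B ε) {n : ℤ} (x : Hom A B n) :
    comp (P.transfer Q x) P.ψ (add_zero n) = comp Q.ψ x (zero_add n) := by
  rw [transfer, assoc Q.ψ _ P.ψ (zero_add n) (add_zero n) (add_zero n) (zero_add n),
    assoc x P.φ P.ψ (q := 0) (add_zero n) rfl (add_zero n) (add_zero n), φ_ψ, DGCategory.comp_id]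

end Perturbation

variable {C : Type u} [DGCategory.{v} C] (P : ChosenPerturbations C)

/-- The dg-functor `[S_ps,loc, C] → [S, C]` of the perturbation lemma. -/
noncomputable def perturbFunctor : DGFunctor (DGFunctor SDRPert C) (DGFunctor SDR C) :=
  ⟨perturb P, perturbMap P, isDGFunctor_perturbMap P⟩

variable {J : Type u₁} [DGCategory.{v₁} J] {F : DGFunctor J (DGFunctor SDRPert C)}

/-- The maps `φ` are isomorphisms of graded objects from the values of the image cone to the values
of the cone `c`. -/
lemma isLimit_perturbFunctor_mapCone {W : LimitWeight.{v₁, u₁, w} J} {c : WeightedCone W F}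
    (hc : ∀ a, ((DGFunctor.eval a).mapCone c).IsLimit) :
    ((perturbFunctor P).mapCone c).IsLimit := by
  refine WeightedCone.isLimit_of_eval _ fun a => ?_
  cases a
  · exact (hc .s).of_iso _ (fun j => (SDRPert.source (F.obj j) P).φ)
      (fun j => (SDRPert.source (F.obj j) P).ψ) (SDRPert.source c.pt P).φ
      (SDRPert.source c.pt P).ψ (fun _ => Perturbation.ψ_φ _) (Perturbation.φ_ψ _)
      (Perturbation.ψ_φ _) (fun _ => Perturbation.φ_transfer _ _ _)
      fun _ => Perturbation.φ_transfer _ _ _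
  · exact (hc .t).of_iso _ (fun j => (SDRPert.target (F.obj j) P).φ)
      (fun j => (SDRPert.target (F.obj j) P).ψ) (SDRPert.target c.pt P).φ
      (SDRPert.target c.pt P).ψ (fun _ => Perturbation.ψ_φ _) (Perturbation.φ_ψ _)
      (Perturbation.ψ_φ _) (fun _ => Perturbation.φ_transfer _ _ _)
      fun _ => Perturbation.φ_transfer _ _ _

/-- The maps `ψ` are isomorphisms of graded objects from the values of the cocone `c` to the values
of the image cocone. -/
lemma isColimit_perturbFunctor_mapCocone {W : ColimitWeight.{v₁, u₁, w} J}
    {c : WeightedCocone W F} (hc : ∀ a, ((DGFunctor.eval a).mapCocone c).IsColimit) :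
    ((perturbFunctor P).mapCocone c).IsColimit := by
  refine WeightedCocone.isColimit_of_eval _ fun a => ?_
  cases a
  · exact (hc .s).of_iso _ (fun j => (SDRPert.source (F.obj j) P).ψ)
      (fun j => (SDRPert.source (F.obj j) P).φ) (SDRPert.source c.pt P).ψ
      (SDRPert.source c.pt P).φ (fun _ => Perturbation.ψ_φ _) (Perturbation.ψ_φ _)
      (Perturbation.φ_ψ _) (fun _ => Perturbation.transfer_ψ _ _ _)
      fun _ => Perturbation.transfer_ψ _ _ _
  · exact (hc .t).of_iso _ (fun j => (SDRPert.target (F.obj j) P).ψ)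
      (fun j => (SDRPert.target (F.obj j) P).φ) (SDRPert.target c.pt P).ψ
      (SDRPert.target c.pt P).φ (fun _ => Perturbation.ψ_φ _) (Perturbation.ψ_φ _)
      (Perturbation.φ_ψ _) (fun _ => Perturbation.transfer_ψ _ _ _)
      fun _ => Perturbation.transfer_ψ _ _ _

end Preservation

theorem mainTheorem5 {C : Type u} [DGCategory.{v} C] (P : ChosenPerturbations C) :
    ∃ (map : ∀ {X Y : DGFunctor SDRPert C} {n : ℤ},
        Hom X Y n → Hom (perturb P X) (perturb P Y) n)
      (hmap : IsDGFunctor (perturb P) map),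
      (∀ {X Y : DGFunctor SDRPert C} {n : ℤ} (φ : Hom X Y n), IsPerturbed P φ (map φ)) ∧
      (∀ {J : Type u₁} [DGCategory.{v₁} J] (W : LimitWeight.{v₁, u₁, w} J)
        (F : DGFunctor J (DGFunctor SDRPert C)) (c : WeightedCone W F), c.IsLimit →
        (∀ a : SDRPert, HasWeightedLimit W ((DGFunctor.eval a).comp F)) →
        ((DGFunctor.mk (perturb P) map hmap).mapCone c).IsLimit) ∧
      (∀ {J : Type u₁} [DGCategory.{v₁} J] (W : ColimitWeight.{v₁, u₁, w} J)
        (F : DGFunctor J (DGFunctor SDRPert C)) (c : WeightedCocone W F), c.IsColimit →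
        (∀ a : SDRPert, HasWeightedColimit W ((DGFunctor.eval a).comp F)) →
        ((DGFunctor.mk (perturb P) map hmap).mapCocone c).IsColimit) := by
  exact ⟨perturbMap P, isDGFunctor_perturbMap P, isPerturbed_perturbMap P,
    fun _ _ _ hc h => isLimit_perturbFunctor_mapCone P (hc.eval h),
    fun _ _ _ hc h => isColimit_perturbFunctor_mapCocone P (hc.eval h)⟩
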